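/- Let $G$ be a finite directed graph with vertex set $V(G)$ and edge set $E(G)$ (loops and multiple edges allowed). A directed cycle is a cyclic sequence of edges $x_0,\dots,x_n$ ($n\ge 0$, taken up to cyclic rotation) such that the terminal vertex of each edge is the initial vertex of the next one (indices modulo $n+1$) and the initial vertices of $x_0,\dots,x_n$ are pairwise distinct. Let $\alpha(G)$ be the maximal number of pairwise edge-disjoint directed cycles in $G$, and let $\gamma_n(G)$ be the number of collections of exactly $n$ pairwise edge-disjoint directed cycles that are maximal under inclusion among all collections of pairwise edge-disjoint directed cycles in $G$. For a vertex $v$ with outgoing edges $x_1,\dots,x_m$ and incoming edges $y_1,\dots,y_k$, and for $1\le l\le \max\{m,k\}$, put $\delta_{v,l}=e_l(x_1,\dots,x_m)-e_l(y_1,\dots,y_k)\in\mathbb{Z}[E(G)]$, where $e_l$ is the $l$-th elementary symmetric polynomial ($e_l=0$ if $l$ exceeds the number of variables). Let $I(G)$ be the ideal of $\mathbb{Z}[E(G)]$ generated by all the $\delta_{v,l}$, and let $P(G)\subset\mathbb{CP}^{|E(G)|-1}$ be the set of points at which all elements of $I(G)$ vanish, with the Zariski topology. The dimension of the empty set is $-1$.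 The degree of a nonempty projective algebraic set of dimension $r$ is the number of points in its intersection with the linear subspace cut out by $r$ generic linear forms. Then: 1. $P(G)$ is the common zero set of the polynomials $\delta_{v,l}$, and it is a union of finitely many linear subspaces of $\mathbb{CP}^{|E(G)|-1}$. 2. $\dim P(G)=\alpha(G)-1$. 3. If $G$ contains a directed cycle, then $\deg P(G)=\gamma_{\alpha(G)}(G)$. If $G$ contains no directed cycle, then $P(G)=\emptyset$ and $\gamma_{\alpha(G)}(G)=\gamma_0(G)=1$. 4. For every $n\ge 1$, the number of irreducible components of $P(G)$ of dimension $n-1$ is $\gamma_n(G)$. -/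

import Mathlib

open scoped LinearAlgebra.Projectivization

/-! ### Complex projective algebraic sets -/

/-- The complex projective space with homogeneous coordinates indexed by the finite type `E`,
that is, projective space of dimension `|E| - 1`. -/
abbrev CProj (E : Type*) := ℙ ℂ (E → ℂ)

namespace CProj

/-- The set of points of projective space at which all polynomials in `S` vanish. A polynomial
vanishes at a point if it vanishes at every vector of homogeneous coordinates of this point (for a
homogeneous polynomial, one vector of coordinates suffices). -/
def zeroLocus {E R : Type*} [CommRing R] [Algebra R ℂ] (S : Set (MvPolynomial E R)) :
    Set (CProj E) :=
  {p | ∀ f ∈ S, ∀ (v : E → ℂ) (hv : v ≠ 0), p = Projectivization.mk ℂ v hv →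
    MvPolynomial.aeval v f = 0}

/-- A projective algebraic set: the common zero set of a set of homogeneous polynomials. -/
def IsAlgebraicSet {E : Type*} (X : Set (CProj E)) : Prop :=
  ∃ S : Set (MvPolynomial E ℂ), (∀ f ∈ S, ∃ n : ℕ, f.IsHomogeneous n) ∧ X = zeroLocus S

theorem isAlgebraicSet_empty {E : Type*} : IsAlgebraicSet (∅ : Set (CProj E)) := by
  refine ⟨{1}, ?_, ?_⟩
  · rintro f rfl
    exact ⟨0, MvPolynomial.isHomogeneous_one E ℂ⟩
  · symm
    rw [Set.eq_empty_iff_forall_notMem]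
    intro p hp
    have h := hp 1 rfl p.rep p.rep_nonzero p.mk_rep.symm
    simp at h

theorem isAlgebraicSet_sInter {E : Type*} (A : Set (Set (CProj E)))
    (hA : ∀ X ∈ A, IsAlgebraicSet X) : IsAlgebraicSet (⋂₀ A) := by
  choose! S hS hX using hA
  refine ⟨⋃ X ∈ A, S X, ?_, ?_⟩
  · intro f hf
    simp only [Set.mem_iUnion] at hf
    obtain ⟨X, hXA, hf⟩ := hf
    exact hS X hXA f hf
  · ext p
    constructor
    · intro hp f hf v hv hpv
      simp only [Set.mem_iUnion] at hf
      obtain ⟨X, hXA, hf⟩ := hf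
      have h : p ∈ X := hp X hXA
      rw [hX X hXA] at h
      exact h f hf v hv hpv
    · intro hp X hXA
      rw [hX X hXA]
      intro f hf
      exact hp f (Set.mem_biUnion hXA hf)

theorem aeval_smul_of_isHomogeneous {E : Type*} {f : MvPolynomial E ℂ} {n : ℕ}
    (hf : f.IsHomogeneous n) (c : ℂ) (v : E → ℂ) :
    MvPolynomial.aeval (c • v) f = c ^ n * MvPolynomial.aeval v f := by
  simp only [MvPolynomial.aeval_def, MvPolynomial.eval₂_eq, Finset.mul_sum]
  refine Finset.sum_congr rfl fun d hd => ?_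
  have h : d.degree = n := by
    rw [Finsupp.degree_eq_weight_one]
    exact hf (MvPolynomial.mem_support_iff.1 hd)
  simp only [Pi.smul_apply, smul_eq_mul, mul_pow, Finset.prod_mul_distrib,
    Finset.prod_pow_eq_pow_sum]
  rw [← h, Finsupp.degree_apply]
  ring

theorem isAlgebraicSet_union {E : Type*} (X Y : Set (CProj E)) (hX : IsAlgebraicSet X)
    (hY : IsAlgebraicSet Y) : IsAlgebraicSet (X ∪ Y) := by
  obtain ⟨S, hS, rfl⟩ := hX
  obtain ⟨T, hT, rfl⟩ := hY
  refine ⟨Set.image2 (fun f g => f * g) S T, ?_, ?_⟩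
  · rintro _ ⟨f, hf, g, hg, rfl⟩
    obtain ⟨m, hm⟩ := hS f hf
    obtain ⟨n, hn⟩ := hT g hg
    exact ⟨m + n, hm.mul hn⟩
  · ext p
    constructor
    · rintro (hp | hp) _ ⟨f, hf, g, hg, rfl⟩ v hv hpv
      · rw [map_mul, hp f hf v hv hpv, zero_mul]
      · rw [map_mul, hp g hg v hv hpv, mul_zero]
    · intro hp
      by_contra hnot
      rw [Set.mem_union, not_or] at hnot
      obtain ⟨h1, h2⟩ := hnot
      simp only [zeroLocus, Set.mem_ofPred_eq, not_forall] at h1 h2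
      obtain ⟨f, hf, v, hv, hpv, hfv⟩ := h1
      obtain ⟨g, hg, w, hw, hpw, hgw⟩ := h2
      obtain ⟨c, rfl⟩ := (Projectivization.mk_eq_mk_iff' ℂ v w hv hw).1 (hpv.symm.trans hpw)
      obtain ⟨m, hm⟩ := hS f hf
      obtain ⟨n, hn⟩ := hT g hg
      have h := hp (f * g) ⟨f, hf, g, hg, rfl⟩ w hw hpw
      rw [map_mul, mul_eq_zero] at h
      rcases h with h | h
      · rw [aeval_smul_of_isHomogeneous hm, h, mul_zero] at hfv
        exact hfv rfl
      · exact hgw h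

/-- The Zariski topology on projective space: the closed sets are the projective algebraic sets.
Subsets of projective space carry the induced topology. -/
instance zariskiTopology (E : Type*) : TopologicalSpace (CProj E) :=
  TopologicalSpace.ofClosed {X | IsAlgebraicSet X} isAlgebraicSet_empty
    (fun A hA => isAlgebraicSet_sInter A hA)
    (fun X hX Y hY => isAlgebraicSet_union X Y hX hY)

/-- The (Zariski) space `T` has dimension `d`: the maximal length of a strictly increasing chain of
irreducible closed subsets of `T` is `d`, where the dimension of the empty space is `-1`. -/
def HasDim (T : Type*) [TopologicalSpace T] (d : ℤ) : Prop :=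
  (IsEmpty T ∧ d = -1) ∨ ∃ r : ℕ, d = r ∧ topologicalKrullDim T = r

/-- The linear subspace of projective space cut out by the linear forms `∑ e, a i e * x e`. -/
def linearSection {E ι : Type*} [Fintype E] (a : ι → E → ℂ) : Set (CProj E) :=
  zeroLocus (Set.range fun i => ∑ e, MvPolynomial.C (a i e) * MvPolynomial.X e)

/-- The nonempty projective algebraic set `X` has degree `d`: if `r` is the dimension of `X`, then
the intersection of `X` with the linear subspace cut out by `r` generic linear forms consists of
exactly `d` points. Here generic means that the coefficients of the `r` linear forms avoid the zero
set of some nonzero polynomial in these coefficients. -/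
def HasDegree {E : Type*} [Fintype E] (X : Set (CProj E)) (d : ℕ) : Prop :=
  ∃ r : ℕ, topologicalKrullDim X = r ∧
    ∃ F : MvPolynomial (Fin r × E) ℂ, F ≠ 0 ∧
      ∀ a : Fin r → E → ℂ, MvPolynomial.aeval (fun k => a k.1 k.2) F ≠ 0 →
        (X ∩ linearSection a).encard = d

end CProj

/-! ### Directed graphs, directed cycles and the incidence set -/

/-- A directed graph with vertex set `V` and edge set `E`; loops and multiple edges are allowed. -/
structure DirectedGraph (V E : Type*) where
  /-- the initial vertex of an edge -/
  src : E → V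
  /-- the terminal vertex of an edge -/
  tgt : E → V

namespace DirectedGraph

variable {V E : Type*}

/-- A directed cycle, given by its cyclic sequence of edges `x₀, …, xₙ` (lists up to rotation):
the terminal vertex of each edge is the initial vertex of the next one, cyclically, and the
vertices (the initial vertices of these edges) are pairwise distinct. -/
def IsDirectedCycle (G : DirectedGraph V E) (c : Cycle E) : Prop :=
  c ≠ Cycle.nil ∧ c.Chain (fun x y => G.tgt x = G.src y) ∧ (c.map G.src).Nodup

/-- A collection of pairwise edge-disjoint directed cycles. -/
def IsEdgeDisjointCollection (G : DirectedGraph V E) (C : Finset (Cycle E)) : Prop :=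
  (∀ c ∈ C, G.IsDirectedCycle c) ∧
    ∀ c ∈ C, ∀ d ∈ C, c ≠ d → ∀ x : E, x ∈ c → x ∉ d

/-- The cycle packing number: the maximal number of pairwise edge-disjoint directed cycles. -/
noncomputable def cyclePackingNumber (G : DirectedGraph V E) : ℕ :=
  sSup {n | ∃ C : Finset (Cycle E), G.IsEdgeDisjointCollection C ∧ C.card = n}

/-- The `n`-th term of the cycle spectrum: the number of collections of exactly `n` pairwise
edge-disjoint directed cycles that are maximal with respect to inclusion among the collections of
pairwise edge-disjoint directed cycles. -/
noncomputable def cycleSpectrum (G : DirectedGraph V E) (n : ℕ) : ℕ :=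
  {C : Finset (Cycle E) | Maximal G.IsEdgeDisjointCollection C ∧ C.card = n}.ncard

open Classical in
/-- The edges having `v` as their initial vertex. -/
noncomputable def outEdges [Fintype E] (G : DirectedGraph V E) (v : V) : Finset E :=
  Finset.univ.filter fun x => G.src x = v

open Classical in
/-- The edges having `v` as their terminal vertex. -/
noncomputable def inEdges [Fintype E] (G : DirectedGraph V E) (v : V) : Finset E :=
  Finset.univ.filter fun x => G.tgt x = v

/-- The degree `l` incidence relation at `v`: the `l`-th elementary symmetric polynomial in the
out-edges of `v` minus the `l`-th elementary symmetric polynomial in the in-edges of `v`. -/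
noncomputable def incidenceRelation [Fintype E] (G : DirectedGraph V E) (v : V) (l : ℕ) :
    MvPolynomial E ℤ :=
  ((G.outEdges v).val.map MvPolynomial.X).esymm l - ((G.inEdges v).val.map MvPolynomial.X).esymm l

/-- The set of all incidence relations of degree `1 ≤ l ≤ k_v` at the vertices `v`, where `k_v` is
the maximum of the out-degree and the in-degree of `v`. -/
noncomputable def incidenceRelations [Fintype E] (G : DirectedGraph V E) : Set (MvPolynomial E ℤ) :=
  {f | ∃ v : V, ∃ l : ℕ, 1 ≤ l ∧ l ≤ max (G.outEdges v).card (G.inEdges v).card ∧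
    f = G.incidenceRelation v l}

/-- The incidence ideal. -/
noncomputable def incidenceIdeal [Fintype E] (G : DirectedGraph V E) : Ideal (MvPolynomial E ℤ) :=
  Ideal.span G.incidenceRelations

/-- The incidence set: the zero set of the incidence ideal in complex projective space. -/
noncomputable def incidenceSet [Fintype E] (G : DirectedGraph V E) : Set (CProj E) :=
  CProj.zeroLocus (G.incidenceIdeal : Set (MvPolynomial E ℤ))

end DirectedGraph

/-!
The relations `δ_{v,l}` say that at each vertex the multisets of values on the outgoing and on the
incoming edges have the same elementary symmetric functions of positive degree, that is, they agree
up to zeros (`Multiset.forall_esymm_eq_iff`). Such a vector is called balanced. Equivalently, for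
each nonzero value, its level set has as many edges out of each vertex as into it. A level set of
this kind contains a directed cycle, and subtracting a multiple of the indicator vector of this
cycle leaves a balanced vector with smaller support. Hence the balanced vectors are exactly those
in the span of the indicator vectors of an edge-disjoint collection of directed cycles
(`DirectedGraph.IsBalanced.exists_mem_cycleSpace`,
`DirectedGraph.IsEdgeDisjointCollection.isBalanced`), and the incidence set is the union of the
linear subspaces spanned by the maximal collections (`DirectedGraph.incidenceSet_eq_biUnion`).

The span of a collection of `n` edge-disjoint cycles has dimension `n`. The spans of the maximal
collections are pairwise incomparable: a vector with distinct nonzero coefficients recovers the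
cycles as its level sets, and a directed cycle contains no other directed cycle
(`DirectedGraph.subset_of_cycleSpace_le`).

What remains is the geometry of a finite union of pairwise incomparable linear subspaces. A nonzero
linear subspace is irreducible, as one sees by restricting polynomials to lines. Its dimension is
bounded above by passing from closed irreducible sets to the prime ideals of their affine cones
and using the Krull dimension of polynomial rings, and bounded below by a flag
(`CProj.topologicalKrullDim_of_range_eq_linearSubspace`). So the subspaces are the irreducible
components, and the dimension is the maximal one. Finally, `r` generic linear forms have no common
zero on a linear subspace of dimension less than `r`, and exactly one on a linear subspace of
dimension `r`; applied to the components and to their pairwise intersections, this gives the degree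
(`CProj.hasDegree_of_eq_biUnion`).
-/

namespace CProj

/-! ### Zero loci of polynomials -/

/-- Membership in a zero locus quantifies over all vectors of homogeneous coordinates, which
matters as the polynomials need not be homogeneous. -/
theorem mk_mem_zeroLocus {E R : Type*} [CommRing R] [Algebra R ℂ] {S : Set (MvPolynomial E R)}
    {v : E → ℂ} (hv : v ≠ 0) :
    Projectivization.mk ℂ v hv ∈ zeroLocus S ↔
      ∀ f ∈ S, ∀ c : ℂ, c ≠ 0 → MvPolynomial.aeval (c • v) f = 0 := by
  constructor
  · intro h f hf c hc
    refine h f hf (c • v) (smul_ne_zero hc hv) ?_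
    rw [Projectivization.mk_eq_mk_iff']
    exact ⟨c⁻¹, by rw [smul_smul, inv_mul_cancel₀ hc, one_smul]⟩
  · intro h f hf w hw hvw
    obtain ⟨c, rfl⟩ := (Projectivization.mk_eq_mk_iff' ℂ w v hw hv).1 hvw.symm
    exact h f hf c (left_ne_zero_of_smul hw)

theorem mem_zeroLocus_iff_forall {E R : Type*} [CommRing R] [Algebra R ℂ]
    {S : Set (MvPolynomial E R)} {p : CProj E} :
    p ∈ zeroLocus S ↔ ∀ f ∈ S, p ∈ zeroLocus {f} := by
  constructor
  · intro h f hf g hg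
    rw [Set.mem_singleton_iff.1 hg]
    exact h f hf
  · intro h f hf
    exact h f hf f rfl

theorem mk_mem_zeroLocus_of_isHomogeneous {E : Type*} {S : Set (MvPolynomial E ℂ)}
    (hS : ∀ f ∈ S, ∃ n : ℕ, f.IsHomogeneous n) {v : E → ℂ} (hv : v ≠ 0) :
    Projectivization.mk ℂ v hv ∈ zeroLocus S ↔ ∀ f ∈ S, MvPolynomial.aeval v f = 0 := by
  rw [mk_mem_zeroLocus]
  constructor
  · intro h f hf
    simpa using h f hf 1 one_ne_zero
  · intro h f hf c _
    obtain ⟨n, hn⟩ := hS f hf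
    rw [aeval_smul_of_isHomogeneous hn, h f hf, mul_zero]

/-- The restriction of the polynomial `F` to the parametrized line `t ↦ a + t • b`. -/
noncomputable def onLine {E : Type*} (a b : E → ℂ) (F : MvPolynomial E ℂ) : Polynomial ℂ :=
  MvPolynomial.aeval (fun e => Polynomial.C (a e) + Polynomial.C (b e) * Polynomial.X) F

theorem eval_onLine {E : Type*} (a b : E → ℂ) (F : MvPolynomial E ℂ) (t : ℂ) :
    (onLine a b F).eval t = MvPolynomial.aeval (a + t • b) F := by
  rw [onLine, ← Polynomial.coe_aeval_eq_eval, ← AlgHom.comp_apply, MvPolynomial.comp_aeval]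
  congr 2
  funext e
  simp only [map_add, map_mul, Polynomial.coe_aeval_eq_eval, Polynomial.eval_C, Polynomial.eval_X,
    Pi.add_apply, Pi.smul_apply, smul_eq_mul, mul_comm t]

theorem onLine_ne_zero {E : Type*} {a b : E → ℂ} {F : MvPolynomial E ℂ} {t : ℂ}
    (h : MvPolynomial.aeval (a + t • b) F ≠ 0) : onLine a b F ≠ 0 := by
  intro h0
  rw [← eval_onLine, h0, Polynomial.eval_zero] at h
  exact h rfl

theorem _root_.Polynomial.exists_eval_ne_zero_of_ne_zero {f : Polynomial ℂ} (hf : f ≠ 0) :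
    ∃ t, f.eval t ≠ 0 := by
  by_contra! h
  exact hf (Polynomial.funext (by simpa using h))

/-- The homogeneous components of `F` have the same common zeros in projective space as `F`:
on the line through a vector `v`, they are the coefficients of the restriction of `F`. -/
theorem zeroLocus_singleton_eq_zeroLocus_homogeneousComponent {E : Type*}
    (F : MvPolynomial E ℂ) :
    zeroLocus {F} = zeroLocus (Set.range fun n => MvPolynomial.homogeneousComponent n F) := by
  have hsum : ∀ (v : E → ℂ) (c : ℂ), MvPolynomial.aeval (c • v) F =
      ∑ n ∈ Finset.range (F.totalDegree + 1),
        c ^ n * MvPolynomial.aeval v (MvPolynomial.homogeneousComponent n F) := by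
    intro v c
    conv_lhs => rw [← MvPolynomial.sum_homogeneousComponent F, map_sum]
    refine Finset.sum_congr rfl fun n _ => ?_
    exact aeval_smul_of_isHomogeneous (MvPolynomial.homogeneousComponent_isHomogeneous n F) c v
  ext p
  induction p using Projectivization.ind with
  | h v hv =>
    rw [mk_mem_zeroLocus, mk_mem_zeroLocus_of_isHomogeneous]
    · simp only [Set.mem_singleton_iff, forall_eq, Set.forall_mem_range]
      constructor
      · intro h n
        by_cases hn : F.totalDegree < n
        · rw [MvPolynomial.homogeneousComponent_eq_zero _ _ hn, map_zero]
        let q : Polynomial ℂ := ∑ n ∈ Finset.range (F.totalDegree + 1),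
          Polynomial.C (MvPolynomial.aeval v (MvPolynomial.homogeneousComponent n F)) *
            Polynomial.X ^ n
        -- The factor `X` accounts for the value `t = 0`, which gives no point of projective space.
        have hq : q * Polynomial.X = 0 := by
          by_contra hne
          obtain ⟨t, ht⟩ := Polynomial.exists_eval_ne_zero_of_ne_zero hne
          rw [Polynomial.eval_mul, Polynomial.eval_X] at ht
          refine left_ne_zero_of_mul ht ?_
          rw [← h t (right_ne_zero_of_mul ht), hsum, Polynomial.eval_finsetSum]
          refine Finset.sum_congr rfl fun n _ => ?_
          rw [Polynomial.eval_mul, Polynomial.eval_C, Polynomial.eval_pow, Polynomial.eval_X,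
            mul_comm]
        have hq0 : q = 0 := (mul_eq_zero.1 hq).resolve_right Polynomial.X_ne_zero
        have := congrArg (fun r => Polynomial.coeff r n) hq0
        simpa [q, Polynomial.finsetSum_coeff, Polynomial.coeff_X_pow, Nat.lt_succ_iff,
          not_lt.1 hn] using this
      · intro h c _
        rw [hsum]
        exact Finset.sum_eq_zero fun n _ => by rw [h n, mul_zero]
    · rintro _ ⟨n, rfl⟩
      exact ⟨n, MvPolynomial.homogeneousComponent_isHomogeneous n F⟩

theorem isClosed_iff_isAlgebraicSet {E : Type*} {X : Set (CProj E)} :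
    IsClosed X ↔ IsAlgebraicSet X :=
  isOpen_compl_iff.symm.trans <| by
    change Xᶜᶜ ∈ {X | IsAlgebraicSet X} ↔ _
    rw [compl_compl]
    rfl

/-- The polynomials need not be homogeneous, as they may be replaced by their homogeneous
components. -/
theorem isClosed_zeroLocus {E : Type*} (S : Set (MvPolynomial E ℂ)) :
    IsClosed (zeroLocus S) := by
  have h : zeroLocus S = ⋂ F ∈ S, zeroLocus {F} := by
    ext p
    rw [mem_zeroLocus_iff_forall]
    simp
  rw [h]
  refine isClosed_biInter fun F _ => ?_
  rw [isClosed_iff_isAlgebraicSet]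
  refine ⟨_, ?_, zeroLocus_singleton_eq_zeroLocus_homogeneousComponent F⟩
  rintro _ ⟨n, rfl⟩
  exact ⟨n, MvPolynomial.homogeneousComponent_isHomogeneous n F⟩

/-! ### Linear subspaces -/

/-- The linear subspace of projective space with underlying vector space `W`. -/
def linearSubspace {E : Type*} (W : Submodule ℂ (E → ℂ)) : Set (CProj E) :=
  W.projectivization

@[simp]
theorem mk_mem_linearSubspace {E : Type*} {W : Submodule ℂ (E → ℂ)} {v : E → ℂ} (hv : v ≠ 0) :
    Projectivization.mk ℂ v hv ∈ linearSubspace W ↔ v ∈ W :=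
  Submodule.mk_mem_projectivization_iff W hv

theorem linearSubspace_subset_iff {E : Type*} {W W' : Submodule ℂ (E → ℂ)} :
    linearSubspace W ⊆ linearSubspace W' ↔ W ≤ W' :=
  Submodule.projectivization.le_iff_le

theorem linearSubspace_nonempty_iff {E : Type*} {W : Submodule ℂ (E → ℂ)} :
    (linearSubspace W).Nonempty ↔ W ≠ ⊥ := by
  rw [Submodule.ne_bot_iff]
  constructor
  · rintro ⟨p, hp⟩
    induction p using Projectivization.ind with
    | h v hv => exact ⟨v, (mk_mem_linearSubspace hv).1 hp, hv⟩
  · rintro ⟨v, hvW, hv⟩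
    exact ⟨_, (mk_mem_linearSubspace hv).2 hvW⟩

/-- The pullback of a polynomial function along a linear map. -/
noncomputable def pullback {E ι : Type*} [Fintype ι] (φ : (ι → ℂ) →ₗ[ℂ] (E → ℂ))
    (F : MvPolynomial E ℂ) : MvPolynomial ι ℂ := by
  classical
  exact MvPolynomial.aeval
    (fun e => ∑ i, MvPolynomial.C (φ (Pi.single i 1) e) * MvPolynomial.X i) F

theorem aeval_pullback {E ι : Type*} [Fintype ι] (φ : (ι → ℂ) →ₗ[ℂ] (E → ℂ))
    (F : MvPolynomial E ℂ) (w : ι → ℂ) :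
    MvPolynomial.aeval w (pullback φ F) = MvPolynomial.aeval (φ w) F := by
  classical
  rw [pullback, ← AlgHom.comp_apply, MvPolynomial.comp_aeval]
  congr 2
  funext e
  conv_rhs => rw [pi_eq_sum_univ' w]
  simp [mul_comm]

theorem isClosed_linearSubspace {E : Type*} [Fintype E] (W : Submodule ℂ (E → ℂ)) :
    IsClosed (linearSubspace W) := by
  obtain ⟨W', hW'⟩ := W.exists_isCompl
  -- The coordinates of a projection with kernel `W` are equations for `W`.
  let π : (E → ℂ) →ₗ[ℂ] (E → ℂ) := W'.subtype ∘ₗ Submodule.projectionOnto W' W hW'.symm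
  have hπ : ∀ v, π v = 0 ↔ v ∈ W := by
    intro v
    simp [π]
  convert isClosed_zeroLocus (Set.range fun e : E => pullback π (MvPolynomial.X e)) using 1
  ext p
  induction p using Projectivization.ind with
  | h v hv =>
    rw [mk_mem_linearSubspace, mk_mem_zeroLocus, ← hπ]
    simp only [Set.forall_mem_range, aeval_pullback, MvPolynomial.aeval_X, map_smul,
      Pi.smul_apply, smul_eq_mul]
    constructor
    · intro h e c _
      rw [h]
      simp
    · intro h
      funext e
      simpa using h e 1 one_ne_zero

/-- A nonzero linear subspace is irreducible: polynomials `F` and `G` that are nonzero at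
points `v` and `w` are both nonzero at some point of the line through `v` and `w`. -/
theorem isIrreducible_linearSubspace {E : Type*} {W : Submodule ℂ (E → ℂ)} (hW : W ≠ ⊥) :
    IsIrreducible (linearSubspace W) := by
  refine ⟨linearSubspace_nonempty_iff.2 hW, ?_⟩
  rw [isPreirreducible_iff_isClosed_union_isClosed]
  intro X Y hX hY hWXY
  by_contra! hnot
  obtain ⟨h1, h2⟩ := hnot
  obtain ⟨S, hS, rfl⟩ := isClosed_iff_isAlgebraicSet.1 hX
  obtain ⟨T, hT, rfl⟩ := isClosed_iff_isAlgebraicSet.1 hY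
  obtain ⟨p, hpW, hp⟩ := Set.not_subset.1 h1
  obtain ⟨q, hqW, hq⟩ := Set.not_subset.1 h2
  induction p using Projectivization.ind with
  | h v hv =>
  induction q using Projectivization.ind with
  | h w hw =>
  rw [mk_mem_linearSubspace] at hpW hqW
  rw [mk_mem_zeroLocus_of_isHomogeneous hS] at hp
  rw [mk_mem_zeroLocus_of_isHomogeneous hT] at hq
  push Not at hp hq
  obtain ⟨F, hF, hFv⟩ := hp
  obtain ⟨G, hG, hGw⟩ := hq
  -- A nonzero coordinate of `v` keeps the chosen point of the line away from the origin.
  obtain ⟨e, he⟩ := Function.ne_iff.1 hv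
  have hF0 : onLine v (w - v) F ≠ 0 := onLine_ne_zero (t := 0) (by simpa using hFv)
  have hG0 : onLine v (w - v) G ≠ 0 := onLine_ne_zero (t := 1) (by simpa using hGw)
  have hX0 : onLine v (w - v) (MvPolynomial.X e) ≠ 0 :=
    onLine_ne_zero (t := 0) (by simpa using he)
  obtain ⟨t, ht⟩ := Polynomial.exists_eval_ne_zero_of_ne_zero
    (mul_ne_zero (mul_ne_zero hF0 hG0) hX0)
  rw [Polynomial.eval_mul, Polynomial.eval_mul, eval_onLine, eval_onLine, eval_onLine,
    mul_ne_zero_iff, mul_ne_zero_iff, MvPolynomial.aeval_X] at ht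
  obtain ⟨⟨htF, htG⟩, htX⟩ := ht
  have hu : v + t • (w - v) ≠ 0 := fun h => htX (by rw [h]; rfl)
  have huW : v + t • (w - v) ∈ W := W.add_mem hpW (W.smul_mem _ (W.sub_mem hqW hpW))
  rcases hWXY ((mk_mem_linearSubspace hu).2 huW) with h | h
  · exact htF ((mk_mem_zeroLocus_of_isHomogeneous hS hu).1 h F hF)
  · exact htG ((mk_mem_zeroLocus_of_isHomogeneous hT hu).1 h G hG)

/-! ### The dimension of linear subspaces -/

/-- The ideal of all polynomials vanishing on the affine cone without its apex over `Z`. -/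
noncomputable def coneIdeal {E : Type*} (Z : Set (CProj E)) : Ideal (MvPolynomial E ℂ) where
  carrier := {f | ∀ (v : E → ℂ) (hv : v ≠ 0), Projectivization.mk ℂ v hv ∈ Z →
    MvPolynomial.aeval v f = 0}
  add_mem' hf hg v hv hvZ := by rw [map_add, hf v hv hvZ, hg v hv hvZ, add_zero]
  zero_mem' v _ _ := map_zero _
  smul_mem' f g hg v hv hvZ := by rw [smul_eq_mul, map_mul, hg v hv hvZ, mul_zero]

/-- A closed set is determined by its cone ideal. -/
theorem subset_of_coneIdeal_le {E : Type*} {Y Z : Set (CProj E)} (hZ : IsClosed Z)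
    (h : coneIdeal Z ≤ coneIdeal Y) : Y ⊆ Z := by
  obtain ⟨S, hS, rfl⟩ := isClosed_iff_isAlgebraicSet.1 hZ
  intro p hp
  induction p using Projectivization.ind with
  | h v hv =>
    rw [mk_mem_zeroLocus_of_isHomogeneous hS]
    intro f hf
    exact h (fun w hw hwZ => (mk_mem_zeroLocus_of_isHomogeneous hS hw).1 hwZ f hf) v hv hp

theorem coneIdeal_isPrime {E : Type*} {Z : Set (CProj E)} (hZ : IsIrreducible Z) :
    (coneIdeal Z).IsPrime := by
  refine ⟨?_, ?_⟩
  · obtain ⟨p, hp⟩ := hZ.nonempty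
    induction p using Projectivization.ind with
    | h v hv =>
      rw [Ideal.ne_top_iff_one]
      intro h
      simpa using h v hv hp
  · intro f g hfg
    -- On the line through a point of `Z`, one of `f` and `g` vanishes identically.
    have hcover : Z ⊆ zeroLocus {f} ∪ zeroLocus {g} := by
      intro p hp
      by_contra hnot
      induction p using Projectivization.ind with
      | h v hv =>
        simp only [Set.mem_union, mk_mem_zeroLocus, Set.mem_singleton_iff, forall_eq] at hnot
        push Not at hnot
        obtain ⟨⟨c, -, hc⟩, d, -, hd⟩ := hnot
        have hf0 : onLine 0 v f ≠ 0 := onLine_ne_zero (t := c) (by simpa using hc)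
        have hg0 : onLine 0 v g ≠ 0 := onLine_ne_zero (t := d) (by simpa using hd)
        obtain ⟨t, ht⟩ := Polynomial.exists_eval_ne_zero_of_ne_zero
          (mul_ne_zero (mul_ne_zero hf0 hg0) Polynomial.X_ne_zero)
        rw [Polynomial.eval_mul, Polynomial.eval_mul, eval_onLine, eval_onLine,
          Polynomial.eval_X, mul_ne_zero_iff, zero_add, ← map_mul] at ht
        have htv : t • v ≠ 0 := smul_ne_zero ht.2 hv
        refine ht.1 (hfg (t • v) htv ?_)
        convert hp using 1
        rw [Projectivization.mk_eq_mk_iff']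
        exact ⟨t, rfl⟩
    have key : ∀ F : MvPolynomial E ℂ, Z ⊆ zeroLocus {F} → F ∈ coneIdeal Z := by
      intro F hF v hv hvZ
      exact hF hvZ F rfl v hv rfl
    rcases isPreirreducible_iff_isClosed_union_isClosed.1 hZ.isPreirreducible _ _
      (isClosed_zeroLocus {f}) (isClosed_zeroLocus {g}) hcover with h | h
    · exact Or.inl (key f h)
    · exact Or.inr (key g h)

/-- The ideal of the origin in affine space. -/
noncomputable def originIdeal (E : Type*) : Ideal (MvPolynomial E ℂ) :=
  RingHom.ker (MvPolynomial.aeval (R := ℂ) (0 : E → ℂ))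

theorem coneIdeal_lt_originIdeal {E : Type*} {Z : Set (CProj E)} (hZ : Z.Nonempty) :
    coneIdeal Z < originIdeal E := by
  obtain ⟨p, hp⟩ := hZ
  induction p using Projectivization.ind with
  | h v hv =>
    refine lt_of_le_of_ne ?_ ?_
    · intro f hf
      have hq : onLine 0 v f * Polynomial.X = 0 := by
        refine Polynomial.funext fun t => ?_
        rw [Polynomial.eval_mul, Polynomial.eval_X, eval_onLine, zero_add, Polynomial.eval_zero]
        rcases eq_or_ne t 0 with rfl | ht
        · simp
        rw [hf (t • v) (smul_ne_zero ht hv), zero_mul]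
        convert hp using 1
        rw [Projectivization.mk_eq_mk_iff']
        exact ⟨t, rfl⟩
      have hq0 := (mul_eq_zero.1 hq).resolve_right Polynomial.X_ne_zero
      have h0 := eval_onLine 0 v f 0
      rw [hq0, Polynomial.eval_zero, zero_smul, add_zero] at h0
      exact h0.symm
    · intro h
      obtain ⟨e, he⟩ := Function.ne_iff.1 hv
      have hX : MvPolynomial.X e ∈ coneIdeal Z := by
        rw [h, originIdeal, RingHom.mem_ker, MvPolynomial.aeval_X]
        rfl
      have := hX v hv hp
      rw [MvPolynomial.aeval_X] at this
      exact he this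

/-- The closed irreducible subsets of projective space, and `⊥` for the empty set, as prime ideals
of the affine coordinate ring, with reversed order. -/
noncomputable def conePrime {E : Type*} :
    WithBot (TopologicalSpace.IrreducibleCloseds (CProj E)) →
      (PrimeSpectrum (MvPolynomial E ℂ))ᵒᵈ
  | ⊥ => OrderDual.toDual ⟨originIdeal E, RingHom.ker_isPrime _⟩
  | (Z : TopologicalSpace.IrreducibleCloseds (CProj E)) =>
    OrderDual.toDual ⟨coneIdeal (Z : Set (CProj E)), coneIdeal_isPrime Z.isIrreducible⟩

theorem conePrime_strictMono {E : Type*} : StrictMono (conePrime (E := E)) := by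
  intro Y Z h
  induction Z using WithBot.recBotCoe with
  | bot => exact absurd h not_lt_bot
  | coe Z =>
    induction Y using WithBot.recBotCoe with
    | bot => exact coneIdeal_lt_originIdeal Z.isIrreducible.nonempty
    | coe Y =>
      have h : Y < Z := WithBot.coe_lt_coe.1 h
      change coneIdeal (Z : Set (CProj E)) < coneIdeal (Y : Set (CProj E))
      refine lt_of_le_not_ge ?_ ?_
      · intro f hf v hv hvY
        exact hf v hv (h.le hvY)
      · intro hle
        exact h.not_ge (subset_of_coneIdeal_le Y.isClosed hle)

/-- A chain of closed irreducible subsets gives a chain of primes below the ideal of the origin,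
whose length is bounded by the Krull dimension of the polynomial ring. -/
theorem topologicalKrullDim_add_one_le {E : Type*} [Fintype E] [Nonempty E] :
    topologicalKrullDim (CProj E) + 1 ≤ Fintype.card E := by
  have hne : Nonempty (TopologicalSpace.IrreducibleCloseds (CProj E)) :=
    ⟨⟨_, isIrreducible_linearSubspace (W := ⊤) top_ne_bot, isClosed_linearSubspace _⟩⟩
  have h := Order.krullDim_le_of_strictMono _ (conePrime_strictMono (E := E))
  rw [Order.krullDim_withBot, Order.krullDim_orderDual] at h
  refine h.trans ?_
  change ringKrullDim _ ≤ _
  rw [MvPolynomial.ringKrullDim_of_isNoetherianRing, ringKrullDim_eq_zero_of_field, zero_add,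
    Nat.card_eq_fintype_card]

end CProj

open Topology in
theorem Topology.IsInducing.isIrreducible_of_image {X Y : Type*} [TopologicalSpace X]
    [TopologicalSpace Y] {f : X → Y} (hf : IsInducing f) {s : Set X}
    (hs : IsIrreducible (f '' s)) : IsIrreducible s := by
  refine ⟨hs.nonempty.of_image, ?_⟩
  rintro u v hu hv ⟨x, hxs, hxu⟩ ⟨y, hys, hyv⟩
  obtain ⟨u', hu', rfl⟩ := hf.isOpen_iff.1 hu
  obtain ⟨v', hv', rfl⟩ := hf.isOpen_iff.1 hv
  obtain ⟨_, ⟨z, hz, rfl⟩, hzu, hzv⟩ := hs.isPreirreducible u' v' hu' hv'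
    ⟨f x, Set.mem_image_of_mem f hxs, hxu⟩ ⟨f y, Set.mem_image_of_mem f hys, hyv⟩
  exact ⟨z, hz, hzu, hzv⟩

/-- The dimension of a finite union of closed subsets is at most the maximum of their
dimensions. -/
theorem topologicalKrullDim_le_of_sUnion {T : Type*} [TopologicalSpace T] {A : Set (Set T)}
    (hA : A.Finite) (hclosed : ∀ Y ∈ A, IsClosed Y) (hcover : ⋃₀ A = Set.univ)
    {d : WithBot ℕ∞} (hd : ∀ Y ∈ A, topologicalKrullDim Y ≤ d) : topologicalKrullDim T ≤ d := by
  rw [topologicalKrullDim, Order.krullDim_eq_iSup_height]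
  refine iSup_le fun Z => ?_
  obtain ⟨Y, hYA, hZY⟩ := isIrreducible_iff_sUnion_isClosed.1 Z.isIrreducible hA.toFinset
    (by simpa using hclosed) (by simp [hcover])
  rw [Set.Finite.mem_toFinset] at hYA
  refine le_trans ?_ (hd Y hYA)
  rw [Order.height_eq_krullDim_Iic]
  have himage : ∀ U : Set.Iic Z,
      (Subtype.val : Y → T) '' (Subtype.val ⁻¹' (U.1 : Set T)) = U.1 := by
    intro U
    rw [Set.image_preimage_eq_iff, Subtype.range_val]
    exact (show (U.1 : Set T) ⊆ Z from U.2).trans hZY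
  let g : Set.Iic Z → TopologicalSpace.IrreducibleCloseds Y := fun U =>
    ⟨Subtype.val ⁻¹' (U.1 : Set T), Topology.IsInducing.subtypeVal.isIrreducible_of_image
      (by rw [himage U]; exact U.1.isIrreducible), U.1.isClosed.preimage continuous_subtype_val⟩
  refine Order.krullDim_le_of_strictMono g (Monotone.strictMono_of_injective ?_ ?_)
  · intro U U' h
    exact Set.preimage_mono (f := (Subtype.val : Y → T)) (show (U.1 : Set T) ⊆ U'.1 from h)
  · intro U U' h
    have h' : Subtype.val ⁻¹' (U.1 : Set T) = (Subtype.val ⁻¹' (U'.1 : Set T) : Set Y) :=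
      congrArg (fun V : TopologicalSpace.IrreducibleCloseds Y => (V : Set Y)) h
    refine Subtype.ext (SetLike.coe_injective ?_)
    rw [← himage U, h', himage U']

namespace CProj

/-- Polynomials can be pulled back along an injective linear map and along a linear left inverse of
it, so the Zariski topology is induced. -/
theorem isInducing_map {E ι : Type*} [Fintype E] [Fintype ι] {φ : (ι → ℂ) →ₗ[ℂ] (E → ℂ)}
    (hφ : Function.Injective φ) :
    Topology.IsInducing (Projectivization.map φ hφ : CProj ι → CProj E) := by
  obtain ⟨ψ, hψ⟩ := φ.exists_leftInverse_of_injective (LinearMap.ker_eq_bot.2 hφ)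
  have hψ' : ∀ w, ψ (φ w) = w := fun w => LinearMap.congr_fun hψ w
  refine ⟨TopologicalSpace.ext_isClosed fun Z => ?_⟩
  rw [isClosed_induced_iff]
  constructor
  · intro hZ
    obtain ⟨S, hS, rfl⟩ := isClosed_iff_isAlgebraicSet.1 hZ
    refine ⟨zeroLocus (pullback ψ '' S), isClosed_zeroLocus _, ?_⟩
    ext p
    induction p using Projectivization.ind with
    | h w hw =>
      rw [Set.mem_preimage, Projectivization.map_mk, mk_mem_zeroLocus, mk_mem_zeroLocus]
      simp only [Set.forall_mem_image, aeval_pullback, map_smul, hψ']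
  · rintro ⟨Y, hY, rfl⟩
    obtain ⟨S, hS, rfl⟩ := isClosed_iff_isAlgebraicSet.1 hY
    convert isClosed_zeroLocus (pullback φ '' S) using 1
    ext p
    induction p using Projectivization.ind with
    | h w hw =>
      rw [Set.mem_preimage, Projectivization.map_mk, mk_mem_zeroLocus, mk_mem_zeroLocus]
      simp only [Set.forall_mem_image, aeval_pullback, map_smul]

theorem range_map {E ι : Type*} {φ : (ι → ℂ) →ₗ[ℂ] (E → ℂ)} (hφ : Function.Injective φ) :
    Set.range (Projectivization.map φ hφ) = linearSubspace φ.range := by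
  ext p
  constructor
  · rintro ⟨q, rfl⟩
    induction q using Projectivization.ind with
    | h w hw =>
      rw [Projectivization.map_mk, mk_mem_linearSubspace]
      exact LinearMap.mem_range_self φ w
  · intro hp
    induction p using Projectivization.ind with
    | h v hv =>
      obtain ⟨w, rfl⟩ := (mk_mem_linearSubspace hv).1 hp
      exact ⟨Projectivization.mk ℂ w (fun h => hv (by rw [h, map_zero])), rfl⟩

theorem topologicalKrullDim_eq (r : ℕ) : topologicalKrullDim (CProj (Fin (r + 1))) = r := by
  refine le_antisymm ?_ ?_
  · have h := topologicalKrullDim_add_one_le (E := Fin (r + 1))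
    rw [Fintype.card_fin, Nat.cast_add, Nat.cast_one] at h
    exact ENat.WithBot.add_le_add_one_right_iff.1 h
  · -- The nonzero members of a complete flag form a chain of length `r`.
    let b := Pi.basisFun ℂ (Fin (r + 1))
    have hne : ∀ i : Fin (r + 1), b.flag i.succ ≠ ⊥ := by
      intro i h
      rw [← b.flag_zero] at h
      exact Fin.succ_ne_zero i (b.flag_strictMono.injective h)
    let s : LTSeries (TopologicalSpace.IrreducibleCloseds (CProj (Fin (r + 1)))) :=
      LTSeries.mk r (fun i => ⟨linearSubspace (b.flag i.succ),
        isIrreducible_linearSubspace (hne i), isClosed_linearSubspace _⟩) (by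
          intro i j hij
          have h := b.flag_strictMono (Fin.succ_lt_succ_iff.2 hij)
          refine lt_of_le_not_ge (linearSubspace_subset_iff.2 h.le) fun hle => ?_
          exact h.not_ge (linearSubspace_subset_iff.1 hle))
    exact Order.LTSeries.length_le_krullDim s

/-- A space that carries the topology induced by a map to projective space whose image is a linear
subspace `W` has the dimension of `W`. -/
theorem topologicalKrullDim_of_range_eq_linearSubspace {E T : Type*} [Fintype E]
    [TopologicalSpace T] {f : T → CProj E} (hf : Topology.IsInducing f)
    {W : Submodule ℂ (E → ℂ)} (hfW : Set.range f = linearSubspace W) {r : ℕ}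
    (hr : Module.finrank ℂ W = r + 1) : topologicalKrullDim T = r := by
  let e : (Fin (r + 1) → ℂ) ≃ₗ[ℂ] W := LinearEquiv.ofFinrankEq _ _ (by simp [hr])
  let φ : (Fin (r + 1) → ℂ) →ₗ[ℂ] (E → ℂ) := W.subtype ∘ₗ e.toLinearMap
  have hφ : Function.Injective φ := W.injective_subtype.comp e.injective
  have hφW : φ.range = W := by simp [φ, LinearMap.range_comp]
  have hind := isInducing_map hφ
  have hrange := range_map hφ
  rw [hφW, ← hfW] at hrange
  have h1 : ∀ t, ∃ q, Projectivization.map φ hφ q = f t := by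
    intro t
    have : f t ∈ Set.range (Projectivization.map φ hφ) := hrange ▸ Set.mem_range_self t
    exact this
  have h2 : ∀ q, ∃ t, f t = Projectivization.map φ hφ q := by
    intro q
    have : Projectivization.map φ hφ q ∈ Set.range f := hrange ▸ Set.mem_range_self q
    exact this
  choose g hg using h1
  choose g' hg' using h2
  rw [← topologicalKrullDim_eq r]
  refine le_antisymm ?_ ?_
  · refine Topology.IsInducing.topologicalKrullDim_le (f := g) ?_
    rw [← hind.of_comp_iff]
    convert hf
    exact funext hg
  · refine Topology.IsInducing.topologicalKrullDim_le (f := g') ?_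
    rw [← hf.of_comp_iff]
    convert hind
    exact funext hg'

/-! ### Finite unions of linear subspaces -/

theorem isInducing_val_val {E : Type*} {X : Set (CProj E)} (Z : Set X) :
    Topology.IsInducing fun z : Z => (z : CProj E) :=
  Topology.IsInducing.subtypeVal.comp Topology.IsInducing.subtypeVal

theorem topologicalKrullDim_preimage_linearSubspace {E : Type*} [Fintype E] {X : Set (CProj E)}
    {W : Submodule ℂ (E → ℂ)} (hWX : linearSubspace W ⊆ X) {r : ℕ}
    (hr : Module.finrank ℂ W = r + 1) :
    topologicalKrullDim (Subtype.val ⁻¹' linearSubspace W : Set X) = r := by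
  refine topologicalKrullDim_of_range_eq_linearSubspace (isInducing_val_val _) ?_ hr
  ext p
  constructor
  · rintro ⟨z, rfl⟩
    exact z.2
  · intro hp
    exact ⟨⟨⟨p, hWX hp⟩, hp⟩, rfl⟩

theorem hasDim_preimage_linearSubspace_iff {E : Type*} [Fintype E] {X : Set (CProj E)}
    {W : Submodule ℂ (E → ℂ)} (hWX : linearSubspace W ⊆ X) (hW : W ≠ ⊥) {n : ℕ} (hn : 1 ≤ n) :
    HasDim (Subtype.val ⁻¹' linearSubspace W : Set X) ((n : ℤ) - 1) ↔
      Module.finrank ℂ W = n := by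
  obtain ⟨r, hr⟩ := Nat.exists_eq_succ_of_ne_zero (Submodule.finrank_eq_zero (S := W).not.2 hW)
  have hdim := topologicalKrullDim_preimage_linearSubspace hWX hr
  rw [HasDim, hdim, hr]
  constructor
  · rintro (⟨-, h⟩ | ⟨m, hm, hrm⟩)
    · omega
    · have : r = m := by exact_mod_cast hrm
      omega
  · intro h
    exact Or.inr ⟨r, by omega, rfl⟩

/-- The zero space has to be excluded, since its linear subspace is empty. -/
theorem irreducibleComponents_of_eq_biUnion {E : Type*} [Fintype E] {X : Set (CProj E)}
    {A : Set (Submodule ℂ (E → ℂ))} (hA : A.Finite) (hanti : IsAntichain (· ≤ ·) A)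
    (hX : X = ⋃ W ∈ A, linearSubspace W) :
    irreducibleComponents X =
      (fun W => Subtype.val ⁻¹' linearSubspace W) '' {W ∈ A | W ≠ ⊥} := by
  have hsub : ∀ W ∈ A, linearSubspace W ⊆ X := by
    intro W hW
    rw [hX]
    exact Set.subset_biUnion_of_mem (u := fun W => linearSubspace W) hW
  have himage : ∀ W ∈ A, (Subtype.val : X → CProj E) '' (Subtype.val ⁻¹' linearSubspace W) =
      linearSubspace W := by
    intro W hW
    rw [Set.image_preimage_eq_iff, Subtype.range_val]
    exact hsub W hW
  have hirr : ∀ W ∈ A, W ≠ ⊥ → IsIrreducible (Subtype.val ⁻¹' linearSubspace W : Set X) := by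
    intro W hW h0
    refine Topology.IsInducing.subtypeVal.isIrreducible_of_image ?_
    rw [himage W hW]
    exact isIrreducible_linearSubspace h0
  have hcover : ∀ Z : Set X, IsIrreducible Z → ∃ W ∈ A, W ≠ ⊥ ∧
      Z ⊆ Subtype.val ⁻¹' linearSubspace W := by
    intro Z hZ
    obtain ⟨Y, hY, hZY⟩ := isIrreducible_iff_sUnion_isClosed.1 hZ
      (hA.image fun W => (Subtype.val ⁻¹' linearSubspace W : Set X)).toFinset
      (by
        simp only [Set.Finite.mem_toFinset, Set.forall_mem_image]
        exact fun W _ => (isClosed_linearSubspace W).preimage continuous_subtype_val)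
      (by
        rintro ⟨p, hp⟩ -
        have hp' := hp
        rw [hX] at hp'
        simpa using hp')
    rw [Set.Finite.mem_toFinset] at hY
    obtain ⟨W, hW, rfl⟩ := hY
    refine ⟨W, hW, ?_, hZY⟩
    obtain ⟨z, hz⟩ := hZ.nonempty
    exact linearSubspace_nonempty_iff.1 ⟨z, hZY hz⟩
  ext Z
  constructor
  · intro hZ
    obtain ⟨W, hW, h0, hZW⟩ := hcover Z hZ.prop
    exact ⟨W, ⟨hW, h0⟩, (hZ.eq_of_subset (hirr W hW h0) hZW).symm⟩
  · rintro ⟨W, ⟨hW, h0⟩, rfl⟩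
    refine ⟨hirr W hW h0, ?_⟩
    intro Z hZ hWZ
    obtain ⟨W', hW', -, hZW'⟩ := hcover Z hZ
    have hle : W ≤ W' := by
      rw [← linearSubspace_subset_iff, ← himage W hW, ← himage W' hW']
      exact Set.image_mono (hWZ.trans hZW')
    rw [hanti.eq hW hW' hle]
    exact hZW'

theorem topologicalKrullDim_of_eq_biUnion {E : Type*} [Fintype E] {X : Set (CProj E)}
    {A : Set (Submodule ℂ (E → ℂ))} (hA : A.Finite)
    (hX : X = ⋃ W ∈ A, linearSubspace W) {r : ℕ} (hle : ∀ W ∈ A, Module.finrank ℂ W ≤ r + 1)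
    (hex : ∃ W ∈ A, Module.finrank ℂ W = r + 1) : topologicalKrullDim X = r := by
  have hsub : ∀ W ∈ A, linearSubspace W ⊆ X := by
    intro W hW
    rw [hX]
    exact Set.subset_biUnion_of_mem (u := fun W => linearSubspace W) hW
  refine le_antisymm ?_ ?_
  · refine topologicalKrullDim_le_of_sUnion
      (hA.image fun W => (Subtype.val ⁻¹' linearSubspace W : Set X)) ?_ ?_ ?_
    · rintro _ ⟨W, -, rfl⟩
      exact (isClosed_linearSubspace W).preimage continuous_subtype_val
    · rw [Set.eq_univ_iff_forall]
      rintro ⟨p, hp⟩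
      have hp' := hp
      rw [hX] at hp'
      simpa using hp'
    · rintro _ ⟨W, hW, rfl⟩
      rcases eq_or_ne W ⊥ with h0 | h0
      · have : IsEmpty (Subtype.val ⁻¹' linearSubspace W : Set X) := by
          rw [Set.isEmpty_coe_sort, Set.eq_empty_iff_forall_notMem]
          intro p hp
          exact linearSubspace_nonempty_iff.1 ⟨_, hp⟩ h0
        have hIC : IsEmpty
            (TopologicalSpace.IrreducibleCloseds (Subtype.val ⁻¹' linearSubspace W : Set X)) :=
          ⟨fun Z => this.false Z.isIrreducible.nonempty.some⟩
        rw [topologicalKrullDim, Order.krullDim_eq_bot]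
        exact bot_le
      · obtain ⟨s, hs⟩ :=
          Nat.exists_eq_succ_of_ne_zero (Submodule.finrank_eq_zero (S := W).not.2 h0)
        rw [topologicalKrullDim_preimage_linearSubspace (hsub W hW) hs]
        have := hle W hW
        have hsr : s ≤ r := by omega
        exact_mod_cast hsr
  · obtain ⟨W, hW, hr⟩ := hex
    rw [← topologicalKrullDim_preimage_linearSubspace (hsub W hW) hr]
    exact topologicalKrullDim_subspace_le _ _

theorem encard_irreducibleComponents_hasDim {E : Type*} [Fintype E] {X : Set (CProj E)}
    {A : Set (Submodule ℂ (E → ℂ))} (hA : A.Finite) (hanti : IsAntichain (· ≤ ·) A)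
    (hX : X = ⋃ W ∈ A, linearSubspace W) {n : ℕ} (hn : 1 ≤ n) :
    {Z ∈ irreducibleComponents X | HasDim Z ((n : ℤ) - 1)}.encard =
      {W ∈ A | Module.finrank ℂ W = n}.encard := by
  have hsub : ∀ W ∈ A, linearSubspace W ⊆ X := by
    intro W hW
    rw [hX]
    exact Set.subset_biUnion_of_mem (u := fun W => linearSubspace W) hW
  have hset : {Z ∈ irreducibleComponents X | HasDim Z ((n : ℤ) - 1)} =
      (fun W => Subtype.val ⁻¹' linearSubspace W) '' {W ∈ A | Module.finrank ℂ W = n} := by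
    rw [irreducibleComponents_of_eq_biUnion hA hanti hX]
    ext Z
    constructor
    · rintro ⟨⟨W, ⟨hW, h0⟩, rfl⟩, hdim⟩
      exact ⟨W, ⟨hW, (hasDim_preimage_linearSubspace_iff (hsub W hW) h0 hn).1 hdim⟩, rfl⟩
    · rintro ⟨W, ⟨hW, hfin⟩, rfl⟩
      have h0 : W ≠ ⊥ := by
        rintro rfl
        rw [finrank_bot] at hfin
        omega
      exact ⟨⟨W, ⟨hW, h0⟩, rfl⟩,
        (hasDim_preimage_linearSubspace_iff (hsub W hW) h0 hn).2 hfin⟩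
  rw [hset]
  refine Set.InjOn.encard_image fun W hW W' hW' h => hanti.eq hW.1 hW'.1 ?_
  rw [← linearSubspace_subset_iff]
  intro p hp
  have : (⟨p, hsub W hW.1 hp⟩ : X) ∈ (Subtype.val ⁻¹' linearSubspace W : Set X) := hp
  rw [show (Subtype.val ⁻¹' linearSubspace W : Set X) = Subtype.val ⁻¹' linearSubspace W' from h]
    at this
  exact this

/-! ### Generic linear sections -/

/-- The property `P` holds for `r` generic linear forms: it holds as soon as the coefficients of
the forms avoid the zero set of a suitable nonzero polynomial. -/
def Generically {E : Type*} {r : ℕ} (P : (Fin r → E → ℂ) → Prop) : Prop :=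
  ∃ F : MvPolynomial (Fin r × E) ℂ, F ≠ 0 ∧
    ∀ a : Fin r → E → ℂ, MvPolynomial.aeval (fun k => a k.1 k.2) F ≠ 0 → P a

theorem Generically.mono {E : Type*} {r : ℕ} {P Q : (Fin r → E → ℂ) → Prop}
    (hP : Generically P) (h : ∀ a, P a → Q a) : Generically Q :=
  let ⟨F, hF, hFP⟩ := hP
  ⟨F, hF, fun a ha => h a (hFP a ha)⟩

theorem Generically.and {E : Type*} {r : ℕ} {P Q : (Fin r → E → ℂ) → Prop}
    (hP : Generically P) (hQ : Generically Q) : Generically fun a => P a ∧ Q a := by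
  obtain ⟨F, hF, hFP⟩ := hP
  obtain ⟨G, hG, hGQ⟩ := hQ
  refine ⟨F * G, mul_ne_zero hF hG, fun a ha => ?_⟩
  rw [map_mul, mul_ne_zero_iff] at ha
  exact ⟨hFP a ha.1, hGQ a ha.2⟩

theorem Generically.forall_mem {E α : Type*} {r : ℕ} {A : Set α} (hA : A.Finite)
    {P : α → (Fin r → E → ℂ) → Prop} (hP : ∀ x ∈ A, Generically (P x)) :
    Generically fun a => ∀ x ∈ A, P x a := by
  induction A, hA using Set.Finite.induction_on with
  | empty => exact ⟨1, one_ne_zero, by simp⟩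
  | insert _ _ ih =>
    simp only [Set.forall_mem_insert] at hP ⊢
    exact hP.1.and (ih hP.2)

/-- The vector space of common zeros of the linear forms with coefficients `a i`. -/
noncomputable def commonKer {E : Type*} [Fintype E] {r : ℕ} (a : Fin r → E → ℂ) :
    Submodule ℂ (E → ℂ) :=
  (Matrix.mulVecLin (Matrix.of a)).ker

theorem mem_commonKer {E : Type*} [Fintype E] {r : ℕ} {a : Fin r → E → ℂ} {v : E → ℂ} :
    v ∈ commonKer a ↔ ∀ i, ∑ e, a i e * v e = 0 := by
  rw [commonKer, LinearMap.mem_ker, Matrix.mulVecLin_apply, funext_iff]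
  rfl

theorem linearSection_eq {E : Type*} [Fintype E] {r : ℕ} (a : Fin r → E → ℂ) :
    linearSection a = linearSubspace (commonKer a) := by
  ext p
  induction p using Projectivization.ind with
  | h v hv =>
    rw [linearSection, mk_mem_zeroLocus_of_isHomogeneous, mk_mem_linearSubspace, mem_commonKer]
    · simp
    · rintro _ ⟨i, rfl⟩
      refine ⟨1, MvPolynomial.IsHomogeneous.sum _ _ _ fun e _ => ?_⟩
      simpa using (MvPolynomial.isHomogeneous_C E (a i e)).mul (MvPolynomial.isHomogeneous_X ℂ e)

theorem linearSubspace_inf {E : Type*} (W W' : Submodule ℂ (E → ℂ)) :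
    linearSubspace (W ⊓ W') = linearSubspace W ∩ linearSubspace W' := by
  ext p
  induction p using Projectivization.ind with
  | h v hv => simp

/-- A vector space of dimension at most `r` meets the common kernel of `r` generic linear forms
only in `0`, because a certain minor of the matrix of the forms on a basis of the space is not the
zero polynomial. -/
theorem generically_inf_commonKer_eq_bot {E : Type*} [Fintype E] {r : ℕ}
    {W : Submodule ℂ (E → ℂ)} (hr : Module.finrank ℂ W ≤ r) :
    Generically fun a : Fin r → E → ℂ => W ⊓ commonKer a = ⊥ := by
  classical
  let b := Module.finBasis ℂ W
  let c : Fin (Module.finrank ℂ W) → Fin r := Fin.castLE hr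
  let N : (Fin r → E → ℂ) →
      Matrix (Fin (Module.finrank ℂ W)) (Fin (Module.finrank ℂ W)) ℂ :=
    fun a => Matrix.of fun i j => ∑ e, a (c i) e * (b j : E → ℂ) e
  let M : Matrix (Fin (Module.finrank ℂ W)) (Fin (Module.finrank ℂ W))
      (MvPolynomial (Fin r × E) ℂ) :=
    Matrix.of fun i j => ∑ e, MvPolynomial.X (c i, e) * MvPolynomial.C ((b j : E → ℂ) e)
  have hM : ∀ a : Fin r → E → ℂ,
      MvPolynomial.aeval (fun k => a k.1 k.2) M.det = (N a).det := by
    intro a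
    rw [AlgHom.map_det]
    congr 1
    ext i j
    simp [M, N]
  refine ⟨M.det, ?_, ?_⟩
  · -- The minor is nonzero at forms which extend the dual basis of `b`.
    choose ℓ hℓ using fun i => (b.coord i).exists_extend
    have hN : N (fun k e => if h : (k : ℕ) < Module.finrank ℂ W then
        ℓ ⟨k, h⟩ (Pi.single e 1) else 0) = 1 := by
      ext i j
      have hsum : ∑ e, ℓ i (Pi.single e 1) * (b j : E → ℂ) e = ℓ i (b j) := by
        conv_rhs => rw [pi_eq_sum_univ' (b j : E → ℂ), map_sum]
        refine Finset.sum_congr rfl fun e _ => ?_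
        rw [map_smul, smul_eq_mul, mul_comm]
      have hcoord : ℓ i (b j) = b.coord i (b j) := LinearMap.congr_fun (hℓ i) (b j)
      simp only [N, c, Matrix.of_apply, Fin.val_castLE, Fin.is_lt, dite_true, Fin.eta]
      rw [hsum, hcoord, Module.Basis.coord_apply, Module.Basis.repr_self, Finsupp.single_apply,
        Matrix.one_apply]
      simp only [eq_comm]
    intro h0
    have h := hM fun k e => if h : (k : ℕ) < Module.finrank ℂ W then
      ℓ ⟨k, h⟩ (Pi.single e 1) else 0
    rw [h0, map_zero, hN, Matrix.det_one] at h
    exact zero_ne_one h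
  · intro a ha
    rw [hM] at ha
    rw [Submodule.eq_bot_iff]
    rintro v ⟨hvW, hva⟩
    rw [SetLike.mem_coe, mem_commonKer] at hva
    have hv : v = ∑ j, b.repr ⟨v, hvW⟩ j • (b j : E → ℂ) := by
      have := congrArg W.subtype (b.sum_repr ⟨v, hvW⟩)
      rw [map_sum] at this
      exact this.symm
    have hker : (N a).mulVec (fun j => b.repr ⟨v, hvW⟩ j) = 0 := by
      funext i
      rw [Pi.zero_apply, ← hva (c i)]
      conv_rhs => rw [hv]
      simp only [Matrix.mulVec, dotProduct, N, Matrix.of_apply, Finset.sum_apply, Pi.smul_apply,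
        smul_eq_mul, Finset.mul_sum, Finset.sum_mul]
      rw [Finset.sum_comm]
      refine Finset.sum_congr rfl fun e _ => Finset.sum_congr rfl fun j _ => by ring
    have hzero := Matrix.eq_zero_of_mulVec_eq_zero ha hker
    rw [hv]
    exact Finset.sum_eq_zero fun j _ => by rw [congrFun hzero j, Pi.zero_apply, zero_smul]

/-- The intersection is nonzero by a dimension count, and generically it meets a subspace of `W` of
codimension one trivially. -/
theorem generically_finrank_inf_commonKer_eq_one {E : Type*} [Fintype E] {r : ℕ}
    {W : Submodule ℂ (E → ℂ)} (hr : Module.finrank ℂ W = r + 1) :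
    Generically fun a : Fin r → E → ℂ => Module.finrank ℂ ↥(W ⊓ commonKer a) = 1 := by
  obtain ⟨W', hW', hfin⟩ : ∃ W' : Submodule ℂ (E → ℂ), W' ≤ W ∧ Module.finrank ℂ W' = r := by
    obtain ⟨f, hf⟩ := exists_linearIndependent_of_le_finrank (R := ℂ) (M := W) (n := r) (by omega)
    refine ⟨Submodule.span ℂ (Set.range fun i => (f i : E → ℂ)), ?_, ?_⟩
    · rw [Submodule.span_le]
      rintro _ ⟨i, rfl⟩
      exact (f i).2
    · have hf' : LinearIndependent ℂ fun i => (f i : E → ℂ) :=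
        hf.map' W.subtype W.ker_subtype
      rw [finrank_span_eq_card hf', Fintype.card_fin]
  refine (generically_inf_commonKer_eq_bot hfin.le).mono fun a ha => ?_
  have hker : Fintype.card E ≤ r + Module.finrank ℂ (commonKer a) := by
    have h1 := (Matrix.mulVecLin (Matrix.of a)).finrank_range_add_finrank_ker
    have h2 := Submodule.finrank_le (Matrix.mulVecLin (Matrix.of a)).range
    rw [Module.finrank_fintype_fun_eq_card] at h1 h2
    rw [Fintype.card_fin] at h2
    rw [commonKer]
    omega
  have h1 := Submodule.finrank_sup_add_finrank_inf_eq W (commonKer a)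
  have h2 := Submodule.finrank_le (W ⊔ commonKer a)
  rw [Module.finrank_fintype_fun_eq_card] at h2
  have h3 := Submodule.finrank_sup_add_finrank_inf_eq W' (W ⊓ commonKer a)
  rw [← inf_assoc, inf_eq_left.2 hW', ha, finrank_bot] at h3
  have h4 := Submodule.finrank_mono (sup_le hW' (inf_le_left : W ⊓ commonKer a ≤ W))
  omega

theorem exists_linearSubspace_eq_singleton {E : Type*} {W : Submodule ℂ (E → ℂ)}
    (hW : Module.finrank ℂ W = 1) : ∃ p, linearSubspace W = {p} := by
  obtain ⟨v, hv, hspan⟩ := finrank_eq_one_iff'.1 hW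
  have hv' : (v : E → ℂ) ≠ 0 := by simpa using hv
  refine ⟨Projectivization.mk ℂ (v : E → ℂ) hv', ?_⟩
  ext p
  induction p using Projectivization.ind with
  | h w hw =>
    rw [mk_mem_linearSubspace, Set.mem_singleton_iff, Projectivization.mk_eq_mk_iff']
    constructor
    · intro hwW
      obtain ⟨c, hc⟩ := hspan ⟨w, hwW⟩
      exact ⟨c, congrArg Subtype.val hc⟩
    · rintro ⟨c, rfl⟩
      exact W.smul_mem c v.2

/-- The degree of a finite union of linear subspaces is the number of subspaces of maximal
dimension. -/
theorem hasDegree_of_eq_biUnion {E : Type*} [Fintype E] {X : Set (CProj E)}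
    {A : Set (Submodule ℂ (E → ℂ))} (hA : A.Finite) (hanti : IsAntichain (· ≤ ·) A)
    (hX : X = ⋃ W ∈ A, linearSubspace W) {r : ℕ} (hle : ∀ W ∈ A, Module.finrank ℂ W ≤ r + 1)
    (hex : ∃ W ∈ A, Module.finrank ℂ W = r + 1) :
    HasDegree X {W ∈ A | Module.finrank ℂ W = r + 1}.ncard := by
  refine ⟨r, topologicalKrullDim_of_eq_biUnion hA hX hle hex, ?_⟩
  change Generically _
  set B := {W ∈ A | Module.finrank ℂ W = r + 1} with hB
  have hBfin : B.Finite := hA.subset (Set.sep_subset _ _)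
  have hlow : Generically fun a : Fin r → E → ℂ =>
      ∀ W ∈ {W ∈ A | Module.finrank ℂ W ≤ r}, W ⊓ commonKer a = ⊥ :=
    Generically.forall_mem (hA.subset (Set.sep_subset _ _))
      fun W hW => generically_inf_commonKer_eq_bot hW.2
  have htop : Generically fun a : Fin r → E → ℂ =>
      ∀ W ∈ B, Module.finrank ℂ ↥(W ⊓ commonKer a) = 1 :=
    Generically.forall_mem hBfin fun W hW => generically_finrank_inf_commonKer_eq_one hW.2
  -- The points cut out on different subspaces differ, as intersections have smaller dimension.
  have hpair : Generically fun a : Fin r → E → ℂ =>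
      ∀ W ∈ B, ∀ W' ∈ B \ {W}, (W ⊓ W') ⊓ commonKer a = ⊥ := by
    refine Generically.forall_mem hBfin fun W hW =>
      Generically.forall_mem hBfin.sdiff fun W' hW' => generically_inf_commonKer_eq_bot ?_
    have hlt : W ⊓ W' < W := by
      refine inf_lt_left.2 fun hle => hW'.2 ?_
      exact (hanti.eq hW.1 hW'.1.1 hle).symm
    have := Submodule.finrank_lt_finrank_of_lt hlt
    rw [hW.2] at this
    omega
  refine (hlow.and (htop.and hpair)).mono ?_
  rintro a ⟨h1, h2, h3⟩
  have : Nonempty (CProj E) := by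
    obtain ⟨W, hW, hfin⟩ := hex
    exact ⟨(exists_linearSubspace_eq_singleton (h2 W ⟨hW, hfin⟩)).choose⟩
  choose! pt hpt using fun W hW => exists_linearSubspace_eq_singleton (h2 W hW)
  have himage : X ∩ linearSection a = pt '' B := by
    rw [linearSection_eq, hX]
    ext p
    simp only [Set.mem_inter_iff, Set.mem_iUnion, exists_prop, Set.mem_image]
    constructor
    · rintro ⟨⟨W, hW, hpW⟩, hpa⟩
      have hp : p ∈ linearSubspace (W ⊓ commonKer a) := by
        rw [linearSubspace_inf]
        exact ⟨hpW, hpa⟩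
      have hWB : W ∈ B := by
        refine ⟨hW, le_antisymm (hle W hW) ?_⟩
        by_contra hlt
        exact linearSubspace_nonempty_iff.1 ⟨p, hp⟩ (h1 W ⟨hW, by omega⟩)
      rw [hpt W hWB] at hp
      exact ⟨W, hWB, hp.symm⟩
    · rintro ⟨W, hWB, rfl⟩
      have hp : pt W ∈ linearSubspace (W ⊓ commonKer a) := by
        rw [hpt W hWB]
        rfl
      rw [linearSubspace_inf] at hp
      exact ⟨⟨W, hWB.1, hp.1⟩, hp.2⟩
  have hinj : Set.InjOn pt B := by
    intro W hW W' hW' h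
    by_contra hne
    refine linearSubspace_nonempty_iff.1 ⟨pt W, ?_⟩ (h3 W hW W' ⟨hW', Ne.symm hne⟩)
    have hp : pt W ∈ linearSubspace (W ⊓ commonKer a) := by
      rw [hpt W hW]
      rfl
    have hp' : pt W ∈ linearSubspace (W' ⊓ commonKer a) := by
      rw [hpt W' hW', h]
      rfl
    rw [linearSubspace_inf] at hp hp'
    rw [linearSubspace_inf, linearSubspace_inf]
    exact ⟨⟨hp.1, hp'.1⟩, hp.2⟩
  rw [himage, hinj.encard_image, hBfin.cast_ncard_eq]

end CProj

/-! ### Elementary symmetric functions and nonzero elements of multisets -/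

namespace Multiset

theorem esymm_zero_cons {R : Type*} [CommSemiring R] (s : Multiset R) (l : ℕ) :
    (0 ::ₘ s).esymm l = s.esymm l := by
  cases l with
  | zero => simp [esymm, powersetCard_zero_left]
  | succ l => simp [esymm, powersetCard_cons]

theorem esymm_replicate_zero_add {R : Type*} [CommSemiring R] (s : Multiset R) (k l : ℕ) :
    (replicate k 0 + s).esymm l = s.esymm l := by
  induction k with
  | zero => simp
  | succ k ih => rw [replicate_succ, cons_add, esymm_zero_cons, ih]

theorem esymm_eq_zero_of_card_lt {R : Type*} [CommSemiring R] {s : Multiset R} {l : ℕ}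
    (h : card s < l) : s.esymm l = 0 := by
  rw [esymm, powersetCard_eq_empty _ h, map_zero, sum_zero]

theorem map_esymm {R S : Type*} [CommSemiring R] [CommSemiring S] (f : R →+* S)
    (s : Multiset R) (l : ℕ) : f (s.esymm l) = (s.map f).esymm l := by
  rw [esymm, esymm, map_multiset_sum, powersetCard_map, map_map, map_map]
  congr 1
  exact map_congr rfl fun t _ => map_multiset_prod f t

theorem eq_of_card_eq_of_esymm_eq {R : Type*} [CommRing R] [IsDomain R] {s t : Multiset R}
    (hcard : card s = card t) (h : ∀ l, s.esymm l = t.esymm l) : s = t := by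
  rw [← Polynomial.roots_multiset_prod_X_sub_C s, ← Polynomial.roots_multiset_prod_X_sub_C t,
    prod_X_sub_X_eq_sum_esymm, prod_X_sub_X_eq_sum_esymm, hcard]
  simp only [h]

theorem esymm_filter_ne_zero {R : Type*} [CommSemiring R] [DecidableEq R] (s : Multiset R)
    (l : ℕ) : (s.filter (· ≠ 0)).esymm l = s.esymm l := by
  conv_rhs => rw [← filter_add_not (· = 0) s, filter_eq', esymm_replicate_zero_add]

theorem sum_map_indicator {R : Type*} [CommSemiring R] [DecidableEq R] (s : Multiset R) (a : R) :
    (s.map fun z => if z = a then (1 : R) else 0).sum = s.count a := by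
  induction s using Multiset.induction_on with
  | empty => simp
  | cons b s ih =>
    rw [map_cons, sum_cons, ih, count_cons]
    by_cases h : b = a
    · simp [h, add_comm]
    · simp [h, Ne.symm h]

/-- Two multisets in a domain of characteristic zero have the same elementary symmetric functions of
positive degree if and only if they agree up to zeros. The latter is expressed by summing all
functions that vanish at `0`. -/
theorem forall_esymm_eq_iff {R : Type*} [CommRing R] [IsDomain R] [CharZero R] {s t : Multiset R} :
    (∀ l, 1 ≤ l → l ≤ max (card s) (card t) → s.esymm l = t.esymm l) ↔
      ∀ f : R → R, f 0 = 0 → (s.map f).sum = (t.map f).sum := by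
  classical
  constructor
  · intro h f hf
    -- Padding with zeros makes the cardinalities equal without changing either side.
    have hpad : replicate (card t) 0 + s = replicate (card s) 0 + t := by
      refine eq_of_card_eq_of_esymm_eq ?_ fun l => ?_
      · simp [add_comm]
      · rw [esymm_replicate_zero_add, esymm_replicate_zero_add]
        rcases Nat.eq_zero_or_pos l with rfl | hl
        · simp [esymm, powersetCard_zero_left]
        · by_cases hmax : l ≤ max (card s) (card t)
          · exact h l hl hmax
          · rw [not_le, max_lt_iff] at hmax
            rw [esymm_eq_zero_of_card_lt hmax.1, esymm_eq_zero_of_card_lt hmax.2]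
    have := congrArg (fun m => (map f m).sum) hpad
    simpa [hf] using this
  · intro h l _ _
    have hfilter : s.filter (· ≠ 0) = t.filter (· ≠ 0) := by
      ext a
      by_cases ha : a = 0
      · rw [count_filter_of_neg (by simpa using ha), count_filter_of_neg (by simpa using ha)]
      · rw [count_filter_of_pos (p := (· ≠ 0)) ha, count_filter_of_pos (p := (· ≠ 0)) ha]
        have := h (fun z => if z = a then 1 else 0) (if_neg (Ne.symm ha))
        rw [sum_map_indicator, sum_map_indicator] at this
        exact_mod_cast this
    rw [← esymm_filter_ne_zero s, ← esymm_filter_ne_zero t, hfilter]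

end Multiset

namespace DirectedGraph

/-! ### Directed cycles -/

/-- Going around a closed path, the terminal vertices are the initial vertices shifted by one. -/
theorem map_tgt_perm_map_src {V E : Type*} {G : DirectedGraph V E} {l : List E}
    (h : (l : Cycle E).Chain (fun x y => G.tgt x = G.src y)) :
    (l.map G.tgt).Perm (l.map G.src) := by
  have key : ∀ (l : List E) (a b : E),
      List.IsChain (fun x y => G.tgt x = G.src y) (a :: (l ++ [b])) →
        (a :: l).map G.tgt = (l ++ [b]).map G.src := by
    intro l
    induction l with
    | nil =>
      intro a b h
      simpa using h
    | cons c l ih =>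
      intro a b h
      rw [List.cons_append, List.isChain_cons_cons] at h
      rw [List.map_cons, ih c b h.2, h.1]
      simp
  cases l with
  | nil => exact List.Perm.refl _
  | cons a l =>
    rw [key l a a h]
    exact (List.perm_append_singleton a l).map G.src

theorem IsDirectedCycle.nodup {V E : Type*} {G : DirectedGraph V E} {c : Cycle E}
    (hc : G.IsDirectedCycle c) : c.Nodup := by
  induction c using Quotient.inductionOn' with
  | h l => exact List.Nodup.of_map G.src hc.2.2

theorem IsDirectedCycle.exists_mem {V E : Type*} {G : DirectedGraph V E} {c : Cycle E}
    (hc : G.IsDirectedCycle c) : ∃ e, e ∈ c := by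
  induction c using Quotient.inductionOn' with
  | h l =>
    have hl : l ≠ [] := fun h => hc.1 (by rw [h]; rfl)
    exact List.exists_mem_of_ne_nil l hl

theorem IsDirectedCycle.eq_of_src_eq {V E : Type*} {G : DirectedGraph V E} {c : Cycle E}
    (hc : G.IsDirectedCycle c) {e e' : E} (he : e ∈ c) (he' : e' ∈ c)
    (h : G.src e = G.src e') : e = e' := by
  induction c using Quotient.inductionOn' with
  | h l => exact List.inj_on_of_nodup_map hc.2.2 he he' h

theorem _root_.Cycle.exists_eq_coe_cons_of_mem {E : Type*} {c : Cycle E} {e : E} (he : e ∈ c) :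
    ∃ l : List E, c = ((e :: l : List E) : Cycle E) := by
  induction c using Quotient.inductionOn' with
  | h k =>
    obtain ⟨s, t, rfl⟩ := List.append_of_mem (show e ∈ k from he)
    exact ⟨t ++ s, Cycle.coe_eq_coe.2 (by rw [← List.cons_append]; exact List.isRotated_append)⟩

/-- A path that leads back to the edge `x` is determined by its first edge if the edges to choose
from have distinct initial vertices. -/
theorem eq_of_isChain_of_isChain {V E : Type*} {G : DirectedGraph V E} {s : Set E}
    (hs : Set.InjOn G.src s) {x : E} (hx : x ∈ s) {l m : List E} {a : E}
    (hl : List.IsChain (fun x y => G.tgt x = G.src y) (a :: (l ++ [x])))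
    (hm : List.IsChain (fun x y => G.tgt x = G.src y) (a :: (m ++ [x])))
    (hls : ∀ e ∈ l, e ∈ s) (hms : ∀ e ∈ m, e ∈ s) (hxl : x ∉ l) (hxm : x ∉ m) : l = m := by
  induction l generalizing m a with
  | nil =>
    cases m with
    | nil => rfl
    | cons b m =>
      simp only [List.nil_append, List.cons_append, List.isChain_cons_cons] at hl hm
      have : x = b := hs hx (hms b List.mem_cons_self) (hl.1.symm.trans hm.1)
      exact absurd (this ▸ List.mem_cons_self) hxm
  | cons b l ih =>
    cases m with
    | nil =>
      simp only [List.nil_append, List.cons_append, List.isChain_cons_cons] at hl hm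
      have : x = b := hs hx (hls b List.mem_cons_self) (hm.1.symm.trans hl.1)
      exact absurd (this ▸ List.mem_cons_self) hxl
    | cons b' m =>
      simp only [List.cons_append, List.isChain_cons_cons] at hl hm
      obtain rfl : b = b' := hs (hls b List.mem_cons_self) (hms b' List.mem_cons_self)
        (hl.1.symm.trans hm.1)
      rw [ih hl.2 hm.2 (fun e he => hls e (List.mem_cons_of_mem b he))
        (fun e he => hms e (List.mem_cons_of_mem b he))
        (fun h => hxl (List.mem_cons_of_mem b h)) (fun h => hxm (List.mem_cons_of_mem b h))]

/-- A directed cycle contains no other directed cycle, since in it every edge has only one possible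
successor. -/
theorem IsDirectedCycle.eq_of_subset {V E : Type*} {G : DirectedGraph V E} {c d : Cycle E}
    (hc : G.IsDirectedCycle c) (hd : G.IsDirectedCycle d) (h : ∀ e, e ∈ d → e ∈ c) : d = c := by
  obtain ⟨x, hx⟩ := hd.exists_mem
  obtain ⟨l, rfl⟩ := Cycle.exists_eq_coe_cons_of_mem hx
  obtain ⟨m, rfl⟩ := Cycle.exists_eq_coe_cons_of_mem (h x hx)
  have hl := Cycle.nodup_coe_iff.1 hd.nodup
  have hm := Cycle.nodup_coe_iff.1 hc.nodup
  rw [eq_of_isChain_of_isChain (s := {e | e ∈ ((x :: m : List E) : Cycle E)})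
    (fun e he e' he' => hc.eq_of_src_eq he he') (h x hx)
    ((Cycle.chain_coe_cons _ x l).1 hd.2.1) ((Cycle.chain_coe_cons _ x m).1 hc.2.1)
    (fun e he => h e (List.mem_cons_of_mem x he)) (fun e he => List.mem_cons_of_mem x he)
    (List.nodup_cons.1 hl).1 (List.nodup_cons.1 hm).1]

theorem finite_setOf_isDirectedCycle {V E : Type*} [Finite E] (G : DirectedGraph V E) :
    {c | G.IsDirectedCycle c}.Finite := by
  classical
  have := Fintype.ofFinite E
  have h : Finite {c : Cycle E // c.Nodup} := Finite.of_fintype _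
  exact Set.Finite.subset (s := {c : Cycle E | c.Nodup}) h fun c hc => hc.nodup

theorem finite_setOf_isEdgeDisjointCollection {V E : Type*} [Finite E] (G : DirectedGraph V E) :
    {C | G.IsEdgeDisjointCollection C}.Finite := by
  refine G.finite_setOf_isDirectedCycle.toFinset.powerset.finite_toSet.subset fun C hC => ?_
  rw [Finset.mem_coe, Finset.mem_powerset]
  intro c hc
  rw [Set.Finite.mem_toFinset]
  exact hC.1 c hc

/-- If every edge in `S` can be followed by an edge in `S`, then `S` contains a directed cycle: let
every edge be followed by an edge that only depends on its terminal vertex, and take a periodic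
orbit. -/
theorem exists_isDirectedCycle {V E : Type*} [Finite E] {G : DirectedGraph V E} {S : Set E}
    (hS : S.Nonempty) (hnext : ∀ e ∈ S, ∃ e' ∈ S, G.src e' = G.tgt e) :
    ∃ c, G.IsDirectedCycle c ∧ ∀ e ∈ c, e ∈ S := by
  obtain ⟨e₀, he₀⟩ := hS
  have : Nonempty E := ⟨e₀⟩
  have hsucc : ∀ v, ∃ e', (∃ e ∈ S, G.tgt e = v) → e' ∈ S ∧ G.src e' = v := by
    intro v
    by_cases hv : ∃ e ∈ S, G.tgt e = v
    · obtain ⟨e, he, rfl⟩ := hv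
      obtain ⟨e', he', h⟩ := hnext e he
      exact ⟨e', fun _ => ⟨he', h⟩⟩
    · exact ⟨e₀, fun h => absurd h hv⟩
  choose s hs using hsucc
  let f : E → E := fun e => s (G.tgt e)
  have hfS : ∀ e ∈ S, f e ∈ S := fun e he => (hs (G.tgt e) ⟨e, he, rfl⟩).1
  have hfsrc : ∀ e ∈ S, G.src (f e) = G.tgt e := fun e he => (hs (G.tgt e) ⟨e, he, rfl⟩).2
  have hiter : ∀ n, ∀ e ∈ S, f^[n] e ∈ S := by
    intro n e he
    exact Set.MapsTo.iterate (s := S) (fun e he => hfS e he) n he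
  obtain ⟨y, hyS, hy⟩ : ∃ y ∈ S, y ∈ Function.periodicPts f := by
    obtain ⟨i, j, hij, h⟩ := Finite.exists_ne_map_eq_of_infinite fun n => f^[n] e₀
    wlog hlt : i < j generalizing i j
    · exact this j i hij.symm h.symm (lt_of_le_of_ne (not_lt.1 hlt) hij.symm)
    refine ⟨f^[i] e₀, hiter i e₀ he₀, Function.mk_mem_periodicPts (Nat.sub_pos_of_lt hlt) ?_⟩
    rw [Function.IsPeriodicPt, Function.IsFixedPt, ← Function.iterate_add_apply,
      Nat.sub_add_cancel hlt.le]
    exact h.symm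
  have horbit : ∀ e ∈ Function.periodicOrbit f y, ∃ e' ∈ S, f e' = e := by
    intro e he
    obtain ⟨n, rfl⟩ := (Function.mem_periodicOrbit_iff hy).1 he
    obtain ⟨p, hp, hper⟩ := Function.mem_periodicPts.1 hy
    refine ⟨f^[n + p - 1] y, hiter _ y hyS, ?_⟩
    rw [← Function.iterate_succ_apply' f, Nat.succ_eq_add_one, Nat.sub_add_cancel (by omega),
      Function.iterate_add_apply, hper]
  refine ⟨Function.periodicOrbit f y, ⟨?_, ?_, ?_⟩, ?_⟩
  · rw [Ne, Function.periodicOrbit_eq_nil_iff_not_periodic_pt, not_not]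
    exact hy
  · rw [Function.periodicOrbit_chain' _ hy]
    intro n
    rw [Function.iterate_succ_apply']
    exact (hfsrc _ (hiter n y hyS)).symm
  · refine List.Nodup.map_on ?_ Function.nodup_periodicOrbit
    intro a ha b hb hab
    obtain ⟨a', ha', rfl⟩ := horbit a ha
    obtain ⟨b', hb', rfl⟩ := horbit b hb
    rw [hfsrc a' ha', hfsrc b' hb'] at hab
    exact congrArg s hab
  · intro e he
    obtain ⟨e', he', rfl⟩ := horbit e he
    exact hfS e' he'

/-! ### Cycle spaces -/

open Classical in
/-- The indicator vector of the edges of `c`. -/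
noncomputable def cycleVec {E : Type*} (c : Cycle E) : E → ℂ := fun e => if e ∈ c then 1 else 0

theorem cycleVec_of_mem {E : Type*} {c : Cycle E} {e : E} (h : e ∈ c) : cycleVec c e = 1 :=
  if_pos h

theorem cycleVec_of_notMem {E : Type*} {c : Cycle E} {e : E} (h : e ∉ c) : cycleVec c e = 0 :=
  if_neg h

/-- The space spanned by the indicator vectors of the cycles in `C`. -/
noncomputable def cycleSpace {E : Type*} (C : Finset (Cycle E)) : Submodule ℂ (E → ℂ) :=
  Submodule.span ℂ (cycleVec '' (C : Set (Cycle E)))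

theorem mem_cycleSpace {E : Type*} {C : Finset (Cycle E)} {x : E → ℂ} :
    x ∈ cycleSpace C ↔ ∃ w : Cycle E → ℂ, ∑ c ∈ C, w c • cycleVec c = x :=
  Submodule.mem_span_image_finset_iff_exists_fun' ℂ

theorem sum_cycleVec_apply_of_mem {V E : Type*} {G : DirectedGraph V E} {C : Finset (Cycle E)}
    (hC : G.IsEdgeDisjointCollection C) (w : Cycle E → ℂ) {c : Cycle E} (hc : c ∈ C) {e : E}
    (he : e ∈ c) : (∑ d ∈ C, w d • cycleVec d) e = w c := by
  rw [Finset.sum_apply, Finset.sum_eq_single_of_mem c hc]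
  · rw [Pi.smul_apply, cycleVec_of_mem he, smul_eq_mul, mul_one]
  · intro d hd hdc
    rw [Pi.smul_apply, cycleVec_of_notMem (hC.2 c hc d hd hdc.symm e he), smul_zero]

theorem sum_cycleVec_apply_of_notMem {E : Type*} {C : Finset (Cycle E)} (w : Cycle E → ℂ) {e : E}
    (he : ∀ c ∈ C, e ∉ c) : (∑ d ∈ C, w d • cycleVec d) e = 0 := by
  rw [Finset.sum_apply]
  refine Finset.sum_eq_zero fun d hd => ?_
  rw [Pi.smul_apply, cycleVec_of_notMem (he d hd), smul_zero]

theorem finrank_cycleSpace {V E : Type*} {G : DirectedGraph V E} {C : Finset (Cycle E)}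
    (hC : G.IsEdgeDisjointCollection C) : Module.finrank ℂ (cycleSpace C) = C.card := by
  have hli : LinearIndependent ℂ fun c : C => cycleVec (c : Cycle E) := by
    classical
    rw [Fintype.linearIndependent_iff]
    intro g hg c
    obtain ⟨e, he⟩ := (hC.1 c c.2).exists_mem
    have h := sum_cycleVec_apply_of_mem hC
      (fun d => if h : d ∈ C then g ⟨d, h⟩ else 0) c.2 he
    rw [← Finset.sum_coe_sort C] at h
    simp only [Finset.coe_mem, dite_true, Subtype.coe_eta] at h
    rw [hg] at h
    exact h.symm
  have h := finrank_span_eq_card hli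
  rw [Fintype.card_coe] at h
  rw [← h, cycleSpace, Set.image_eq_range]
  rfl

/-- Distinct nonzero coefficients single out the cycles in `C` as the level sets of a vector in
the cycle space of `C`. In the cycle space of `D`, level sets are unions of cycles in `D`. -/
theorem subset_of_cycleSpace_le {V E : Type*} [Finite E] {G : DirectedGraph V E}
    {C D : Finset (Cycle E)} (hC : G.IsEdgeDisjointCollection C)
    (hD : G.IsEdgeDisjointCollection D) (h : cycleSpace C ≤ cycleSpace D) : C ⊆ D := by
  obtain ⟨g, hg⟩ := Set.countable_iff_exists_injOn.1 C.countable_toSet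
  let w : Cycle E → ℂ := fun c => (g c : ℂ) + 1
  have hw0 : ∀ c, w c ≠ 0 := fun c => Nat.cast_add_one_ne_zero (g c)
  have hw : ∀ c ∈ C, ∀ d ∈ C, w c = w d → c = d := by
    intro c hc d hd hcd
    exact hg hc hd (by exact_mod_cast add_right_cancel hcd)
  obtain ⟨w', hw'⟩ := mem_cycleSpace.1 (h (mem_cycleSpace.2 ⟨w, rfl⟩))
  intro c hc
  obtain ⟨e, he⟩ := (hC.1 c hc).exists_mem
  have hec := sum_cycleVec_apply_of_mem hC w hc he
  obtain ⟨d, hd, hed⟩ : ∃ d ∈ D, e ∈ d := by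
    by_contra! hnot
    rw [← hw', sum_cycleVec_apply_of_notMem w' hnot] at hec
    exact hw0 c hec.symm
  have hdc : d = c := by
    refine (hC.1 c hc).eq_of_subset (hD.1 d hd) fun e' he' => ?_
    have he'c : (∑ d ∈ C, w d • cycleVec d) e' = w c := by
      rw [← hw', sum_cycleVec_apply_of_mem hD w' hd he', ← sum_cycleVec_apply_of_mem hD w' hd hed,
        hw', hec]
    obtain ⟨c', hc', hec'⟩ : ∃ c' ∈ C, e' ∈ c' := by
      by_contra! hnot
      rw [sum_cycleVec_apply_of_notMem w hnot] at he'c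
      exact hw0 c he'c.symm
    rw [sum_cycleVec_apply_of_mem hC w hc' hec'] at he'c
    exact hw c' hc' c hc he'c ▸ hec'
  exact hdc ▸ hd

/-! ### Balanced vectors -/

/-- A vector is balanced if, at each vertex, its nonzero values on the outgoing edges and on the
incoming edges agree, counted with multiplicities. This is expressed by summing all functions that
vanish at `0`. -/
def IsBalanced {V E : Type*} [Fintype E] (G : DirectedGraph V E) (x : E → ℂ) : Prop :=
  ∀ (u : V) (f : ℂ → ℂ), f 0 = 0 → ∑ e ∈ G.outEdges u, f (x e) = ∑ e ∈ G.inEdges u, f (x e)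

theorem mem_outEdges {V E : Type*} [Fintype E] {G : DirectedGraph V E} {u : V} {e : E} :
    e ∈ G.outEdges u ↔ G.src e = u := by simp [outEdges]

theorem mem_inEdges {V E : Type*} [Fintype E] {G : DirectedGraph V E} {u : V} {e : E} :
    e ∈ G.inEdges u ↔ G.tgt e = u := by simp [inEdges]

theorem IsDirectedCycle.sum_cycleVec {V E : Type*} [Fintype E] {G : DirectedGraph V E}
    {c : Cycle E} (hc : G.IsDirectedCycle c) (u : V) :
    ∑ e ∈ G.outEdges u, cycleVec c e = ∑ e ∈ G.inEdges u, cycleVec c e := by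
  classical
  induction c using Quotient.inductionOn' with
  | h l =>
    have key : ∀ (h : E → V) (A : Finset E), (∀ e, e ∈ A ↔ h e = u) →
        ∑ e ∈ A, cycleVec (l : Cycle E) e =
          ((l.map h).map fun v => if v = u then (1 : ℂ) else 0).sum := by
      intro h A hA
      obtain rfl : A = Finset.univ.filter (fun e => h e = u) := by
        ext e
        simp [hA]
      rw [List.map_map, ← List.sum_toFinset _ (Cycle.nodup_coe_iff.1 hc.nodup), Finset.sum_filter]
      have hsub : l.toFinset ⊆ Finset.univ := Finset.subset_univ _
      rw [← Finset.sum_subset hsub]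
      · refine Finset.sum_congr rfl fun e he => ?_
        rw [cycleVec_of_mem (List.mem_toFinset.1 he)]
        rfl
      · intro e _ he
        rw [cycleVec_of_notMem (fun h => he (List.mem_toFinset.2 h)), ite_self]
    have h := ((map_tgt_perm_map_src hc.2.1).map fun v => if v = u then (1 : ℂ) else 0).sum_eq
    rw [← key G.tgt (G.inEdges u) fun _ => mem_inEdges,
      ← key G.src (G.outEdges u) fun _ => mem_outEdges] at h
    exact h.symm

theorem IsEdgeDisjointCollection.isBalanced {V E : Type*} [Fintype E] {G : DirectedGraph V E}
    {C : Finset (Cycle E)} (hC : G.IsEdgeDisjointCollection C) {x : E → ℂ}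
    (hx : x ∈ cycleSpace C) : G.IsBalanced x := by
  obtain ⟨w, rfl⟩ := mem_cycleSpace.1 hx
  intro u f hf
  have hval : ∀ e, f ((∑ c ∈ C, w c • cycleVec c) e) = ∑ c ∈ C, f (w c) * cycleVec c e := by
    intro e
    have hsum : (∑ c ∈ C, f (w c) • cycleVec c) e = ∑ c ∈ C, f (w c) * cycleVec c e := by
      simp
    rw [← hsum]
    by_cases he : ∃ c ∈ C, e ∈ c
    · obtain ⟨c, hc, hec⟩ := he
      rw [sum_cycleVec_apply_of_mem hC w hc hec,
        sum_cycleVec_apply_of_mem hC (fun c => f (w c)) hc hec]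
    · push Not at he
      rw [sum_cycleVec_apply_of_notMem w he, hf,
        sum_cycleVec_apply_of_notMem (fun c => f (w c)) he]
  simp only [hval]
  rw [Finset.sum_comm, Finset.sum_comm (s := G.inEdges u)]
  refine Finset.sum_congr rfl fun c hc => ?_
  rw [← Finset.mul_sum, ← Finset.mul_sum, (hC.1 c hc).sum_cycleVec u]

/-- The level set of a nonzero value has as many edges out of each vertex as into it, so every edge
in it can be continued. -/
theorem IsBalanced.exists_isDirectedCycle {V E : Type*} [Fintype E] {G : DirectedGraph V E}
    {x : E → ℂ} (hx : G.IsBalanced x) {e₀ : E} (he₀ : x e₀ ≠ 0) :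
    ∃ c, G.IsDirectedCycle c ∧ ∀ e ∈ c, x e = x e₀ := by
  classical
  refine DirectedGraph.exists_isDirectedCycle (S := {e | x e = x e₀}) ⟨e₀, rfl⟩ fun e he => ?_
  by_contra! hnot
  have h := hx (G.tgt e) (fun z => if z = x e₀ then 1 else 0) (if_neg he₀.symm)
  rw [Finset.sum_eq_zero, Finset.sum_boole, eq_comm, Nat.cast_eq_zero, Finset.card_eq_zero,
    Finset.filter_eq_empty_iff] at h
  · exact h (mem_inEdges.2 rfl) he
  · intro e' he'
    exact if_neg fun h' => hnot e' h' (mem_outEdges.1 he')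

theorem IsBalanced.sub_smul_cycleVec {V E : Type*} [Fintype E] {G : DirectedGraph V E}
    {x : E → ℂ} (hx : G.IsBalanced x) {c : Cycle E} (hc : G.IsDirectedCycle c) {z : ℂ}
    (hz : ∀ e ∈ c, x e = z) : G.IsBalanced (x - z • cycleVec c) := by
  intro u f hf
  have hval : ∀ e, f ((x - z • cycleVec c) e) = f (x e) - f z * cycleVec c e := by
    intro e
    rw [Pi.sub_apply, Pi.smul_apply, smul_eq_mul]
    by_cases he : e ∈ c
    · rw [cycleVec_of_mem he, hz e he, mul_one, mul_one, sub_self, sub_self, hf]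
    · rw [cycleVec_of_notMem he, mul_zero, mul_zero, sub_zero, sub_zero]
  simp only [hval]
  rw [Finset.sum_sub_distrib, Finset.sum_sub_distrib, ← Finset.mul_sum, ← Finset.mul_sum,
    hx u f hf, hc.sum_cycleVec u]

/-- Every balanced vector lies in the cycle space of an edge-disjoint collection: subtract multiples
of the indicator vectors of cycles on which the vector is constant. -/
theorem IsBalanced.exists_mem_cycleSpace {V E : Type*} [Fintype E] {G : DirectedGraph V E}
    {x : E → ℂ} (hx : G.IsBalanced x) :
    ∃ C, G.IsEdgeDisjointCollection C ∧ x ∈ cycleSpace C ∧ ∀ c ∈ C, ∀ e ∈ c, x e ≠ 0 := by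
  classical
  induction hn : (Finset.univ.filter fun e => x e ≠ 0).card using Nat.strong_induction_on
    generalizing x with
  | h n ih =>
  by_cases h0 : x = 0
  · refine ⟨∅, ⟨by simp, by simp⟩, ?_, by simp⟩
    rw [h0]
    exact Submodule.zero_mem _
  · obtain ⟨e₀, he₀⟩ := Function.ne_iff.1 h0
    obtain ⟨c, hc, hcx⟩ := hx.exists_isDirectedCycle he₀
    have hon : ∀ e ∈ c, (x - x e₀ • cycleVec c) e = 0 := by
      intro e he
      rw [Pi.sub_apply, Pi.smul_apply, cycleVec_of_mem he, hcx e he, smul_eq_mul, mul_one,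
        sub_self]
    have hoff : ∀ e, e ∉ c → (x - x e₀ • cycleVec c) e = x e := by
      intro e he
      rw [Pi.sub_apply, Pi.smul_apply, cycleVec_of_notMem he, smul_zero, sub_zero]
    obtain ⟨a, ha⟩ := hc.exists_mem
    obtain ⟨C, hC, hxC, hsupp⟩ := ih _ (by
      rw [← hn]
      refine Finset.card_lt_card (Finset.ssubset_iff_of_subset ?_ |>.2 ⟨a, ?_, ?_⟩)
      · intro e he
        rw [Finset.mem_filter] at he ⊢
        refine ⟨Finset.mem_univ e, ?_⟩
        rw [← hoff e fun h => he.2 (hon e h)]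
        exact he.2
      · rw [Finset.mem_filter, hcx a ha]
        exact ⟨Finset.mem_univ a, he₀⟩
      · rw [Finset.mem_filter, hon a ha]
        exact fun h => h.2 rfl) (hx.sub_smul_cycleVec hc hcx) rfl
    have hdisj : ∀ d ∈ C, ∀ e ∈ d, e ∉ c := fun d hd e he h => hsupp d hd e he (hon e h)
    refine ⟨insert c C, ⟨?_, ?_⟩, ?_, ?_⟩
    · intro d hd
      rcases Finset.mem_insert.1 hd with rfl | hd
      · exact hc
      · exact hC.1 d hd
    · intro d hd d' hd' hne e hed hed'
      rcases Finset.mem_insert.1 hd with rfl | hd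
      · rcases Finset.mem_insert.1 hd' with rfl | hd'
        · exact hne rfl
        · exact hdisj d' hd' e hed' hed
      · rcases Finset.mem_insert.1 hd' with hd' | hd'
        · exact hdisj d hd e hed (hd' ▸ hed')
        · exact hC.2 d hd d' hd' hne e hed hed'
    · rw [← sub_add_cancel x (x e₀ • cycleVec c)]
      refine Submodule.add_mem _ ?_ (Submodule.smul_mem _ _ (Submodule.subset_span ?_))
      · refine Submodule.span_mono (Set.image_mono ?_) hxC
        exact Finset.coe_subset.2 (Finset.subset_insert c C)
      · exact Set.mem_image_of_mem _ (Finset.mem_insert_self c C)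
    · intro d hd e he
      rcases Finset.mem_insert.1 hd with rfl | hd
      · rw [hcx e he]
        exact he₀
      · rw [← hoff e (hdisj d hd e he)]
        exact hsupp d hd e he

/-! ### The incidence set -/

theorem incidenceSet_eq_zeroLocus {V E : Type*} [Fintype E] (G : DirectedGraph V E) :
    G.incidenceSet = CProj.zeroLocus G.incidenceRelations := by
  ext p
  constructor
  · intro hp f hf
    exact hp f (Ideal.subset_span hf)
  · intro hp f hf v hv hpv
    have hle : G.incidenceIdeal ≤ RingHom.ker (MvPolynomial.aeval (R := ℤ) v) :=
      Ideal.span_le.2 fun g hg => hp g hg v hv hpv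
    exact hle hf

theorem aeval_incidenceRelation {V E : Type*} [Fintype E] (G : DirectedGraph V E) (u : V) (l : ℕ)
    (x : E → ℂ) : MvPolynomial.aeval x (G.incidenceRelation u l) =
      ((G.outEdges u).val.map x).esymm l - ((G.inEdges u).val.map x).esymm l := by
  have h : ∀ s : Multiset E, MvPolynomial.aeval x ((s.map MvPolynomial.X).esymm l :
      MvPolynomial E ℤ) = (s.map x).esymm l := by
    intro s
    have := Multiset.map_esymm (MvPolynomial.aeval (R := ℤ) x : MvPolynomial E ℤ →ₐ[ℤ] ℂ).toRingHom
      (s.map MvPolynomial.X) l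
    rw [Multiset.map_map] at this
    refine this.trans ?_
    congr 1
    exact Multiset.map_congr rfl fun e _ => MvPolynomial.aeval_X x e
  rw [incidenceRelation, map_sub, h, h]

theorem forall_incidenceRelations_iff_isBalanced {V E : Type*} [Fintype E]
    (G : DirectedGraph V E) (x : E → ℂ) :
    (∀ f ∈ G.incidenceRelations, MvPolynomial.aeval x f = 0) ↔ G.IsBalanced x := by
  have h : ∀ u, (∀ l, 1 ≤ l → l ≤ max (G.outEdges u).card (G.inEdges u).card →
      MvPolynomial.aeval x (G.incidenceRelation u l) = 0) ↔
      ∀ f : ℂ → ℂ, f 0 = 0 → ∑ e ∈ G.outEdges u, f (x e) = ∑ e ∈ G.inEdges u, f (x e) := by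
    intro u
    have := Multiset.forall_esymm_eq_iff (s := (G.outEdges u).val.map x)
      (t := (G.inEdges u).val.map x)
    simp only [Multiset.card_map, Multiset.map_map, Finset.card_val] at this
    simp only [aeval_incidenceRelation, sub_eq_zero]
    exact this
  constructor
  · intro hx u
    exact (h u).1 fun l h1 h2 => hx _ ⟨u, l, h1, h2, rfl⟩
  · rintro hx _ ⟨u, l, h1, h2, rfl⟩
    exact (h u).2 (hx u) l h1 h2

/-- The cycle spaces of the maximal collections of edge-disjoint directed cycles. -/
def maximalCycleSpaces {V E : Type*} (G : DirectedGraph V E) : Set (Submodule ℂ (E → ℂ)) :=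
  cycleSpace '' {C | Maximal G.IsEdgeDisjointCollection C}

theorem finite_maximalCycleSpaces {V E : Type*} [Finite E] (G : DirectedGraph V E) :
    G.maximalCycleSpaces.Finite :=
  (G.finite_setOf_isEdgeDisjointCollection.subset fun _ hC => hC.prop).image _

theorem eq_of_maximal_of_cycleSpace_le {V E : Type*} [Finite E] {G : DirectedGraph V E}
    {C D : Finset (Cycle E)} (hC : Maximal G.IsEdgeDisjointCollection C)
    (hD : Maximal G.IsEdgeDisjointCollection D) (h : cycleSpace C ≤ cycleSpace D) : C = D :=
  hC.eq_of_le hD.prop (subset_of_cycleSpace_le hC.prop hD.prop h)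

theorem isAntichain_maximalCycleSpaces {V E : Type*} [Finite E] (G : DirectedGraph V E) :
    IsAntichain (· ≤ ·) G.maximalCycleSpaces := by
  rintro _ ⟨C, hC, rfl⟩ _ ⟨D, hD, rfl⟩ hne hle
  exact hne (congrArg cycleSpace (eq_of_maximal_of_cycleSpace_le hC hD hle))

theorem exists_maximal_ge {V E : Type*} [Finite E] {G : DirectedGraph V E} {C : Finset (Cycle E)}
    (hC : G.IsEdgeDisjointCollection C) :
    ∃ D, C ⊆ D ∧ Maximal G.IsEdgeDisjointCollection D :=
  G.finite_setOf_isEdgeDisjointCollection.exists_le_maximal hC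

theorem incidenceSet_eq_biUnion {V E : Type*} [Fintype E] (G : DirectedGraph V E) :
    G.incidenceSet = ⋃ W ∈ G.maximalCycleSpaces, CProj.linearSubspace W := by
  rw [incidenceSet_eq_zeroLocus]
  ext p
  induction p using Projectivization.ind with
  | h v hv =>
    simp only [CProj.mk_mem_zeroLocus, Set.mem_iUnion, CProj.mk_mem_linearSubspace, exists_prop]
    constructor
    · intro h
      have hbal : G.IsBalanced v := by
        rw [← forall_incidenceRelations_iff_isBalanced]
        intro f hf
        simpa using h f hf 1 one_ne_zero
      obtain ⟨C, hC, hvC, -⟩ := hbal.exists_mem_cycleSpace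
      obtain ⟨D, hCD, hD⟩ := exists_maximal_ge hC
      exact ⟨cycleSpace D, ⟨D, hD, rfl⟩,
        Submodule.span_mono (Set.image_mono (Finset.coe_subset.2 hCD)) hvC⟩
    · rintro ⟨_, ⟨C, hC, rfl⟩, hvC⟩ f hf c _
      refine (forall_incidenceRelations_iff_isBalanced G (c • v)).2 ?_ f hf
      exact hC.prop.isBalanced (Submodule.smul_mem _ c hvC)

theorem cycleSpectrum_eq {V E : Type*} [Finite E] (G : DirectedGraph V E) (n : ℕ) :
    G.cycleSpectrum n = {W ∈ G.maximalCycleSpaces | Module.finrank ℂ W = n}.ncard := by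
  have h : {W ∈ G.maximalCycleSpaces | Module.finrank ℂ W = n} =
      cycleSpace '' {C | Maximal G.IsEdgeDisjointCollection C ∧ C.card = n} := by
    ext W
    constructor
    · rintro ⟨⟨C, hC, rfl⟩, hn⟩
      rw [finrank_cycleSpace hC.prop] at hn
      exact ⟨C, ⟨hC, hn⟩, rfl⟩
    · rintro ⟨C, ⟨hC, hn⟩, rfl⟩
      exact ⟨⟨C, hC, rfl⟩, (finrank_cycleSpace hC.prop).trans hn⟩
  rw [h, Set.InjOn.ncard_image]
  · rfl
  · intro C hC D hD hCD
    exact eq_of_maximal_of_cycleSpace_le hC.1 hD.1 hCD.le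

/-! ### The cycle packing number -/

theorem isEdgeDisjointCollection_empty {V E : Type*} (G : DirectedGraph V E) :
    G.IsEdgeDisjointCollection ∅ := ⟨by simp, by simp⟩

theorem bddAbove_card {V E : Type*} [Finite E] (G : DirectedGraph V E) :
    BddAbove {n | ∃ C : Finset (Cycle E), G.IsEdgeDisjointCollection C ∧ C.card = n} :=
  (G.finite_setOf_isEdgeDisjointCollection.image Finset.card).bddAbove

theorem IsEdgeDisjointCollection.card_le {V E : Type*} [Finite E] {G : DirectedGraph V E}
    {C : Finset (Cycle E)} (hC : G.IsEdgeDisjointCollection C) :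
    C.card ≤ G.cyclePackingNumber :=
  le_csSup G.bddAbove_card ⟨C, hC, rfl⟩

theorem exists_maximal_card_eq {V E : Type*} [Finite E] (G : DirectedGraph V E) :
    ∃ C, Maximal G.IsEdgeDisjointCollection C ∧ C.card = G.cyclePackingNumber := by
  have hne : {n | ∃ C : Finset (Cycle E), G.IsEdgeDisjointCollection C ∧ C.card = n}.Nonempty :=
    ⟨0, ∅, G.isEdgeDisjointCollection_empty, rfl⟩
  obtain ⟨C, hC, hcard⟩ := Nat.sSup_mem hne G.bddAbove_card
  obtain ⟨D, hCD, hD⟩ := exists_maximal_ge hC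
  refine ⟨D, hD, le_antisymm hD.prop.card_le ?_⟩
  exact hcard.symm.trans_le (Finset.card_le_card hCD)

theorem IsDirectedCycle.isEdgeDisjointCollection_singleton {V E : Type*} {G : DirectedGraph V E}
    {c : Cycle E} (hc : G.IsDirectedCycle c) : G.IsEdgeDisjointCollection {c} := by
  refine ⟨by simpa using hc, ?_⟩
  intro d hd d' hd' hne
  rw [Finset.mem_singleton] at hd hd'
  exact absurd (hd.trans hd'.symm) hne

theorem cyclePackingNumber_eq_zero_iff {V E : Type*} [Finite E] {G : DirectedGraph V E} :
    G.cyclePackingNumber = 0 ↔ ¬ ∃ c, G.IsDirectedCycle c := by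
  constructor
  · rintro h ⟨c, hc⟩
    have := hc.isEdgeDisjointCollection_singleton.card_le
    rw [h, Finset.card_singleton] at this
    omega
  · intro h
    obtain ⟨C, hC, hcard⟩ := G.exists_maximal_card_eq
    rw [← hcard, Finset.card_eq_zero, Finset.eq_empty_iff_forall_notMem]
    exact fun c hc => h ⟨c, hC.prop.1 c hc⟩

theorem isEdgeDisjointCollection_iff_of_acyclic {V E : Type*} {G : DirectedGraph V E}
    (h : ¬ ∃ c, G.IsDirectedCycle c) {C : Finset (Cycle E)} :
    G.IsEdgeDisjointCollection C ↔ C = ∅ := by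
  constructor
  · intro hC
    rw [Finset.eq_empty_iff_forall_notMem]
    exact fun c hc => h ⟨c, hC.1 c hc⟩
  · rintro rfl
    exact G.isEdgeDisjointCollection_empty

theorem maximal_iff_of_acyclic {V E : Type*} {G : DirectedGraph V E}
    (h : ¬ ∃ c, G.IsDirectedCycle c) {C : Finset (Cycle E)} :
    Maximal G.IsEdgeDisjointCollection C ↔ C = ∅ := by
  constructor
  · intro hC
    exact (isEdgeDisjointCollection_iff_of_acyclic h).1 hC.prop
  · rintro rfl
    refine ⟨G.isEdgeDisjointCollection_empty, fun D hD _ => ?_⟩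
    exact ((isEdgeDisjointCollection_iff_of_acyclic h).1 hD).le

theorem incidenceSet_eq_empty_of_acyclic {V E : Type*} [Fintype E] {G : DirectedGraph V E}
    (h : ¬ ∃ c, G.IsDirectedCycle c) : G.incidenceSet = ∅ := by
  rw [incidenceSet_eq_biUnion, Set.eq_empty_iff_forall_notMem]
  intro p hp
  simp only [Set.mem_iUnion, exists_prop] at hp
  obtain ⟨_, ⟨C, hC, rfl⟩, hp⟩ := hp
  refine CProj.linearSubspace_nonempty_iff.1 ⟨p, hp⟩ ?_
  rw [(maximal_iff_of_acyclic h).1 hC]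
  simp [cycleSpace]

theorem finrank_le_of_mem_maximalCycleSpaces {V E : Type*} [Finite E] {G : DirectedGraph V E}
    {W : Submodule ℂ (E → ℂ)} (hW : W ∈ G.maximalCycleSpaces) :
    Module.finrank ℂ W ≤ G.cyclePackingNumber := by
  obtain ⟨C, hC, rfl⟩ := hW
  rw [finrank_cycleSpace hC.prop]
  exact hC.prop.card_le

theorem exists_mem_maximalCycleSpaces_finrank_eq {V E : Type*} [Finite E]
    (G : DirectedGraph V E) :
    ∃ W ∈ G.maximalCycleSpaces, Module.finrank ℂ W = G.cyclePackingNumber := by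
  obtain ⟨C, hC, hcard⟩ := G.exists_maximal_card_eq
  exact ⟨cycleSpace C, ⟨C, hC, rfl⟩, (finrank_cycleSpace hC.prop).trans hcard⟩

end DirectedGraph

theorem mainTheorem1 {V E : Type*} [Finite V] [Fintype E] (G : DirectedGraph V E) :
    -- the incidence set is cut out by the incidence relations
    G.incidenceSet = CProj.zeroLocus G.incidenceRelations ∧
    -- it is a union of finitely many linear subspaces
    (∃ L : Set (Projectivization.Subspace ℂ (E → ℂ)), L.Finite ∧
      G.incidenceSet = ⋃ T ∈ L, (T : Set (CProj E))) ∧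
    -- its dimension (`-1` if it is empty)
    CProj.HasDim G.incidenceSet ((G.cyclePackingNumber : ℤ) - 1) ∧
    -- its degree if `G` has a directed cycle, and the remaining case, where it is empty
    ((∃ c, G.IsDirectedCycle c) →
      CProj.HasDegree G.incidenceSet (G.cycleSpectrum G.cyclePackingNumber)) ∧
    ((¬ ∃ c, G.IsDirectedCycle c) →
      G.incidenceSet = ∅ ∧ G.cycleSpectrum G.cyclePackingNumber = 1) ∧
    -- the number of its irreducible components of each dimension
    (∀ n : ℕ, 1 ≤ n →
      {Z ∈ irreducibleComponents G.incidenceSet | CProj.HasDim Z ((n : ℤ) - 1)}.encard =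
        G.cycleSpectrum n) := by
  have hfin := G.finite_maximalCycleSpaces
  have hanti := G.isAntichain_maximalCycleSpaces
  have hX := G.incidenceSet_eq_biUnion
  refine ⟨G.incidenceSet_eq_zeroLocus, ?_, ?_, ?_, ?_, ?_⟩
  · refine ⟨Submodule.projectivization '' G.maximalCycleSpaces, hfin.image _, ?_⟩
    rw [Set.biUnion_image]
    exact hX
  · by_cases h : ∃ c, G.IsDirectedCycle c
    · obtain ⟨r, hr⟩ := Nat.exists_eq_succ_of_ne_zero
        fun h0 => DirectedGraph.cyclePackingNumber_eq_zero_iff.1 h0 h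
      refine Or.inr ⟨r, by omega, CProj.topologicalKrullDim_of_eq_biUnion hfin hX ?_ ?_⟩
      · exact fun W hW => (DirectedGraph.finrank_le_of_mem_maximalCycleSpaces hW).trans_eq hr
      · simpa only [hr] using G.exists_mem_maximalCycleSpaces_finrank_eq
    · left
      rw [DirectedGraph.incidenceSet_eq_empty_of_acyclic h,
        DirectedGraph.cyclePackingNumber_eq_zero_iff.2 h]
      exact ⟨inferInstance, rfl⟩
  · intro h
    obtain ⟨r, hr⟩ := Nat.exists_eq_succ_of_ne_zero
      fun h0 => DirectedGraph.cyclePackingNumber_eq_zero_iff.1 h0 h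
    rw [DirectedGraph.cycleSpectrum_eq, hr]
    refine CProj.hasDegree_of_eq_biUnion hfin hanti hX ?_ ?_
    · exact fun W hW => (DirectedGraph.finrank_le_of_mem_maximalCycleSpaces hW).trans_eq hr
    · simpa only [hr] using G.exists_mem_maximalCycleSpaces_finrank_eq
  · intro h
    refine ⟨DirectedGraph.incidenceSet_eq_empty_of_acyclic h, ?_⟩
    rw [DirectedGraph.cyclePackingNumber_eq_zero_iff.2 h, DirectedGraph.cycleSpectrum,
      Set.ncard_eq_one]
    refine ⟨∅, ?_⟩
    ext C
    rw [Set.mem_singleton_iff, Set.mem_ofPred_eq, DirectedGraph.maximal_iff_of_acyclic h,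
      and_iff_left_of_imp fun hC => by rw [hC, Finset.card_empty]]
  · intro n hn
    rw [CProj.encard_irreducibleComponents_hasDim hfin hanti hX hn, DirectedGraph.cycleSpectrum_eq,
      (hfin.subset (Set.sep_subset _ _)).cast_ncard_eq]
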